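/- Let $N$ be a finite ground set with $|N| = n$, let $f : 2^N \to \mathbb{R}_{\ge 0}$ be submodular, and let $f_{\max} \ge \max_{S \subseteq N} f(S)$. Let $\mathcal{I}$ be (the independent sets of) a matroid on $N$ of rank $r$, and $O^* \in \arg\max_{S \in \mathcal{I}} f(S)$. Let $\tilde f(S) = \xi_S f(S)$ be a noisy value oracle, where the multipliers $(\xi_S)_{S \subseteq N}$ are independent, non-negative, with a common law $\mathcal{D}$ of mean $1$ that is sub-exponential with parameters $(\nu, a)$, $a \ge 0$: $\mathbb{E}[e^{\lambda(\xi - \mathbb{E}\xi)}] \le e^{\nu^2\lambda^2/2}$ whenever $|\lambda| \le 1/a$ (all $\lambda$ if $a = 0$). The oracle is persistent: each $\xi_S$ is drawn once. Let $0 < \varepsilon < \frac{2\nu^2}{a} f_{\max}$ (for $a=0$: $\varepsilon>0$ and $\nu^2 f_{\max}>0$), and let the integers $h, t, m$ satisfy $$ m \ge \max\{2, 8\nu^2\}\, \frac{f_{\max}^2}{\varepsilon^2}\, \big(n + \log(4n)\big), \qquad t \ge \log_2(4m), \qquad h = t^2, \qquad h < r. $$ Let $\mathcal{A}$ be a randomized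 adaptive algorithm that, given a matroid and a value oracle for a function on the subsets of its ground set, queries subsets of the ground set and returns an independent set. For $H \subseteq N$ independent, write $\mathcal{I}_H = \{S \subseteq N \setminus H : S \cup H \in \mathcal{I}\}$ for the contracted matroid, with ground set $N\setminus H$. The meta-algorithm takes a fixed (arbitrary) basis $B_0$ of $\mathcal{I}$, samples $H \subseteq B_0$ of size $h$ uniformly, samples $m$ distinct subsets $H_1, \dots, H_m$ of $H$ of size $t$ uniformly without replacement, runs $\mathcal{A}$ on $\mathcal{I}_H$ with the oracle $\hat F(S) = \frac1m \sum_{i=1}^m \tilde f(S \cup H_i)$ to obtain $S_H \in \mathcal{I}_H$, samples $H' \subseteq H$ of size $t$ uniformly and independently, and returns $\mathrm{ALG} = S_H \cup H'$. Let $\mathfrak{M}$ be a class of matroids containing $\mathcal{I}_H$ for every $H\subseteq B_0$ with $|H|=h$. For a class of non-negative submodular functions, say that $\mathcal{A}$ has approximation ratio $\alpha \ge 0$ if, for every matroid $\mathcal{J} \in \mathfrak{M}$ and every $g$ of the class on its ground set, running $\mathcal{A}$ with the exact oracle $g$ gives a set $S_{\mathcal{A}}$ with $\mathbb{E}[g(S_{\mathcal{A}})]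 \ge \alpha \max_{S \in \mathcal{J}} g(S)$; and that it is $\beta(\varepsilon)$-robust against $\varepsilon$-approximate oracles if, for all such $\mathcal{J}, g$ and every $\hat g$ with $|\hat g(S) - g(S)| \le \varepsilon$ for all subsets $S$ of the ground set, running $\mathcal{A}$ with the oracle $\hat g$ gives a set $\hat S_{\mathcal{A}}$ with $\mathbb{E}[g(\hat S_{\mathcal{A}})] \ge \alpha \max_{S \in \mathcal{J}} g(S) - \beta(\varepsilon)$. Then: 1. If $\mathcal{A}$ has approximation ratio $\alpha$ and is $\beta(\varepsilon)$-robust against $\varepsilon$-approximate oracles for the class of all non-negative submodular functions, then $$\mathbb{E}[f(\mathrm{ALG})] \ge \alpha\Big(1 - \frac{h}{r-h} - \frac{t}{h-t} - \frac1n\Big) f(O^*) - \beta(\varepsilon).$$ 2. If $f$ is monotone and $\mathcal{A}$ has approximation ratio $\alpha$ and is $\beta(\varepsilon)$-robust against $\varepsilon$-approximate oracles for the class of non-negative monotone submodular functions, then $$\mathbb{E}[f(\mathrm{ALG})] \ge \alpha\Big(1 - \frac{h}{r-h} - \frac1n\Big) f(O^*) - \beta(\varepsilon).$$ 3. The meta-algorithm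 is well defined ($H$ has at least $m$ subsets of size $t$) and always returns a set in $\mathcal{I}$. 4. In every run, the number of queries to $\tilde f$ is exactly $m$ times the number of oracle queries made by $\mathcal{A}$ in that run; hence in the worst case it is at most $m \cdot Q(\mathcal{A})$, where $Q(\mathcal{A})$ is the worst-case number of queries of $\mathcal{A}$ on matroids of $\mathfrak{M}$. -/

import Mathlib

open MeasureTheory ProbabilityTheory
open scoped BigOperators Matroid

noncomputable section

namespace NoisySubmodular

universe u v w

/-! ### Set functions and constraints -/

/-- `f` is non-negative and submodular on the subsets of the ground set `E`: marginal values
decrease. -/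
structure NonnegSubmodularOn {N : Type u} [DecidableEq N] (E : Set N) (f : Finset N → ℝ) : Prop where
  nonneg : ∀ S : Finset N, (S : Set N) ⊆ E → 0 ≤ f S
  submod : ∀ A B : Finset N, A ⊆ B → (B : Set N) ⊆ E → ∀ x ∈ E, x ∉ B →
    f (insert x B) - f B ≤ f (insert x A) - f A

/-- `f` is non-negative, submodular and monotone on the subsets of `E`. -/
structure NonnegMonotoneSubmodularOn {N : Type u} [DecidableEq N] (E : Set N) (f : Finset N → ℝ) : Prop
    extends NonnegSubmodularOn E f where
  mono : ∀ A B : Finset N, A ⊆ B → (B : Set N) ⊆ E → f A ≤ f B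

/-- `O ∈ argmax {f S : S independent in M}`. -/
def IsOptimal {N : Type u} (M : Matroid N) (f : Finset N → ℝ) (O : Finset N) : Prop :=
  M.Indep (O : Set N) ∧ ∀ S : Finset N, M.Indep (S : Set N) → f S ≤ f O

/-! ### Adaptive value-oracle computations -/

/-- A deterministic adaptive computation with a value oracle: it either stops and returns a set,
or queries the value of a set and continues depending on the answer. -/
inductive QueryProg (N : Type u) : Type u
  | ret (S : Finset N) : QueryProg N
  | query (S : Finset N) (k : ℝ → QueryProg N) : QueryProg N

namespace QueryProg

/-- The set returned when the queries are answered by `g`. -/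
def run {N : Type u} (g : Finset N → ℝ) : QueryProg N → Finset N
  | ret S => S
  | query S k => run g (k (g S))

/-- The sets queried, in order and with repetitions, when the queries are answered by `g`. -/
def queries {N : Type u} (g : Finset N → ℝ) : QueryProg N → List (Finset N)
  | ret _ => []
  | query S k => S :: queries g (k (g S))

/-- The number of queries made when they are answered by `g`. -/
def numQueries {N : Type u} (g : Finset N → ℝ) (p : QueryProg N) : ℕ :=
  (p.queries g).length

/-- Query all the sets of a list, add the answers to `acc`, and continue with the total. -/
def querySum {N : Type u} : List (Finset N) → ℝ → (ℝ → QueryProg N) → QueryProg N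
  | [], acc, k => k acc
  | S :: L, acc, k => query S fun y => querySum L (acc + y) k

/-- Replace each query `S` by the `m` queries `S ∪ H₁, …, S ∪ Hₘ`, answering it with the average
of the `m` values, and finally add `H'` to the returned set. -/
def smooth {N : Type u} [DecidableEq N] {m : ℕ} (Hs : Fin m → Finset N) (H' : Finset N) :
    QueryProg N → QueryProg N
  | ret S => ret (S ∪ H')
  | query S k =>
      querySum (List.ofFn fun i => S ∪ Hs i) 0 fun total => smooth Hs H' (k (total / m))

end QueryProg

/-- A randomized algorithm with a value oracle for maximizing set functions over the independent
sets of a matroid (whose ground set is a subset of `N`): given the matroid and a random seed, it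
queries subsets of the ground set adaptively and returns an independent set. -/
structure Algorithm (N : Type u) where
  Seed : Type v
  [seedSpace : MeasurableSpace Seed]
  μ : Measure Seed
  [isProb : IsProbabilityMeasure μ]
  prog : Matroid N → Seed → QueryProg N
  measurable_run : ∀ (M : Matroid N) (T : Finset N),
    MeasurableSet {p : Seed × (Finset N → ℝ) | (prog M p.1).run p.2 = T}
  query_subset : ∀ (M : Matroid N) (s : Seed) (g : Finset N → ℝ),
    ∀ S ∈ (prog M s).queries g, (S : Set N) ⊆ M.E
  indep_run : ∀ (M : Matroid N) (s : Seed) (g : Finset N → ℝ),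
    M.Indep ((prog M s).run g : Set N)

attribute [instance] Algorithm.seedSpace Algorithm.isProb

/-- `g` is an `ε`-approximate oracle for `f` on the subsets of `E`. -/
def IsApproxOracle {N : Type u} (E : Set N) (ε : ℝ) (f g : Finset N → ℝ) : Prop :=
  ∀ S : Finset N, (S : Set N) ⊆ E → |g S - f S| ≤ ε

namespace Algorithm

/-- `𝔼[f(S)]`, where `S` is the set that `A` returns on the matroid `M` with the oracle `g`. -/
def expectedValue {N : Type u} (A : Algorithm.{u, v} N) (M : Matroid N) (g f : Finset N → ℝ) : ℝ :=
  ∫ s, f ((A.prog M s).run g) ∂A.μ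

/-- With the exact value oracle, `A` is an `α`-approximation for maximizing functions of the class
`𝓕` (a property of functions on a ground set) under matroid constraints of the class `𝓜`. -/
def HasApproxRatio {N : Type u} (A : Algorithm.{u, v} N) (𝓜 : Set (Matroid N))
    (𝓕 : Set N → (Finset N → ℝ) → Prop) (α : ℝ) : Prop :=
  ∀ M ∈ 𝓜, ∀ f : Finset N → ℝ, 𝓕 M.E f → ∀ O, IsOptimal M f O →
    α * f O ≤ A.expectedValue M f f

/-- `A`, as an `α`-approximation for the classes `𝓜` and `𝓕`, is `b`-robust against
`ε`-approximate oracles. -/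
def IsRobust {N : Type u} (A : Algorithm.{u, v} N) (𝓜 : Set (Matroid N))
    (𝓕 : Set N → (Finset N → ℝ) → Prop) (α ε b : ℝ) : Prop :=
  ∀ M ∈ 𝓜, ∀ f : Finset N → ℝ, 𝓕 M.E f → ∀ g : Finset N → ℝ, IsApproxOracle M.E ε f g →
    ∀ O, IsOptimal M f O → α * f O - b ≤ A.expectedValue M g f

/-- The query complexity of `A`: the largest number of queries it makes on a matroid of the
class `𝓜`, over all seeds and all oracles. -/
def queryComplexity {N : Type u} (A : Algorithm.{u, v} N) (𝓜 : Set (Matroid N)) : ℕ∞ :=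
  ⨆ (M ∈ 𝓜) (s : A.Seed) (g : Finset N → ℝ), ((A.prog M s).numQueries g : ℕ∞)

end Algorithm

/-! ### The noisy value oracle -/

/-- `D` is sub-exponential with parameters `(ν, a)`. The condition `|l| ≤ 1 / a` is written
`|l| * a ≤ 1`, so that it is no restriction for `a = 0`. -/
def IsSubExponential (D : Measure ℝ) (ν a : ℝ) : Prop :=
  ∀ l : ℝ, |l| * a ≤ 1 →
    Integrable (fun x => Real.exp (l * (x - ∫ y, y ∂D))) D ∧
      ∫ x, Real.exp (l * (x - ∫ y, y ∂D)) ∂D ≤ Real.exp (ν ^ 2 * l ^ 2 / 2)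

/-- `ξ` is a family of noise multipliers with law `D`: non-negative, unbiased, and independent
across sets. -/
structure IsNoise {N : Type u} {Ω : Type w} [MeasurableSpace Ω] (P : Measure Ω)
    (ξ : Finset N → Ω → ℝ) (D : Measure ℝ) : Prop where
  measurable : ∀ S, Measurable (ξ S)
  law : ∀ S, P.map (ξ S) = D
  nonneg : ∀ᵐ x ∂D, 0 ≤ x
  integrable : Integrable (fun x : ℝ => x) D
  unbiased : ∫ x, x ∂D = 1
  indep : iIndepFun ξ P

/-- The persistent noisy oracle `S ↦ ξ_S f(S)` at the outcome `ω`. -/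
def noisyOracle {N : Type u} {Ω : Type w} (ξ : Finset N → Ω → ℝ) (f : Finset N → ℝ) (ω : Ω) :
    Finset N → ℝ :=
  fun S => ξ S ω * f S

/-! ### The meta-algorithm -/

/-- The sample average `S ↦ (1/m) ∑ᵢ g(S ∪ Hᵢ)`. -/
def sampleAverage {N : Type u} [DecidableEq N] {m : ℕ} (g : Finset N → ℝ) (Hs : Fin m → Finset N) :
    Finset N → ℝ :=
  fun S => (∑ i, g (S ∪ Hs i)) / m

/-- The possible outcomes of sampling `m` subsets of `H` of size `t` without replacement. -/
def samples {N : Type u} [DecidableEq N] (H : Finset N) (t m : ℕ) :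
    Finset (Fin m → Finset N) :=
  {Hs ∈ Fintype.piFinset fun _ : Fin m => H.powersetCard t |
    ∀ i j, Hs i = Hs j → i = j}

/-- The meta-algorithm, for given outcomes of its random choices: run `A` (with seed `s`) on the
contraction of `M` by `H`, each query `S` being answered by the average of the oracle over
`S ∪ H₁, …, S ∪ Hₘ`, and add `H'` to the set obtained. -/
def metaProg {N : Type u} [DecidableEq N] (A : Algorithm.{u, v} N) (M : Matroid N) {m : ℕ}
    (H : Finset N) (Hs : Fin m → Finset N) (H' : Finset N) (s : A.Seed) : QueryProg N :=
  (A.prog (M ／ (H : Set N)) s).smooth Hs H'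

/-- `𝔼[f(ALG)]` for the meta-algorithm run on the noisy oracle: `H` is a uniform subset of `B₀` of
size `h`, the sets `H₁, …, Hₘ` are sampled from the subsets of `H` of size `t` without replacement,
`H'` is an independent uniform subset of `H` of size `t`, and the noise and the seed of `A` are
independent of each other and of these choices. -/
def metaExpectedValue {N : Type u} [DecidableEq N] {Ω : Type w} [MeasurableSpace Ω]
    (A : Algorithm.{u, v} N) (M : Matroid N) (B₀ : Finset N) (h t m : ℕ) (P : Measure Ω)
    (ξ : Finset N → Ω → ℝ) (f : Finset N → ℝ) : ℝ :=
  𝔼 H ∈ B₀.powersetCard h, 𝔼 Hs ∈ samples H t m, 𝔼 H' ∈ H.powersetCard t,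
    ∫ p : Ω × A.Seed, f ((metaProg A M H Hs H' p.2).run (noisyOracle ξ f p.1)) ∂(P.prod A.μ)

/-- The largest number of oracle queries made by the meta-algorithm on `M`, over all outcomes of
its random choices and all oracles. -/
def metaQueryComplexity {N : Type u} [DecidableEq N] (A : Algorithm.{u, v} N) (M : Matroid N)
    (B₀ : Finset N) (h t m : ℕ) : ℕ∞ :=
  ⨆ (H ∈ B₀.powersetCard h) (Hs ∈ samples H t m) (H' ∈ H.powersetCard t) (s : A.Seed)
    (g : Finset N → ℝ), ((metaProg A M H Hs H' s).numQueries g : ℕ∞)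

/-- The condition on the parameters `h, t, m`. -/
def ParamCondition (n : ℕ) (ν fmax ε δ : ℝ) (h t m : ℕ) : Prop :=
  max 2 (8 * ν ^ 2) * (fmax ^ 2 / ε ^ 2) * (n + Real.log (4 / δ)) ≤ m ∧
    Real.logb 2 (4 * m) ≤ t ∧ h = t ^ 2

end NoisySubmodular

end

open MeasureTheory ProbabilityTheory
open scoped BigOperators Matroid

namespace NoisySubmodular

universe u v w

/-! ### Averages over subsets of a fixed size -/

/-! The proof replaces `f` on the contraction `M ／ H` by `smoothed f H t`, the average of `f (S ∪
T)` over the `t`-subsets `T` of `H`. This function is again non-negative and submodular (and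
monotone if `f` is), so the guarantees of `A` apply to it. Since `H'` is independent of everything
`A` sees, adding it to the output of `A` yields in expectation exactly the smoothed value of that
output (`expect_integral_metaProg`). Three losses remain.

Contraction and smoothing share one averaging argument, `le_expect_powersetCard`: if adding a random
new element loses at most one share out of those left, the losses telescope to `k / |B|`. For
smoothing (`NonnegSubmodularOn.le_expect_union`) the hypothesis is submodularity plus
non-negativity. For contraction (`contractValue_step`) an optimal set is extended to a basis and
matched injectively with `B₀` by Hall's theorem (`exists_injOn_exchange`): contracting one more `x`
costs only the partner of `x`, and the costs of distinct partners sum to at most the whole value.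

The third loss is the probability that the averaged noisy oracle is not `ε`-approximate. Its error
splits into a sampling part, controlled by Hoeffding's inequality without replacement
(`card_injTuples_abs_ge_le`), and a noise part, controlled by Chernoff's bound
(`IsNoise.measureReal_abs_sum_ge_le`). Persistence is harmless inside an average because the sets `S
∪ Hᵢ` are distinct. Each part is made smaller than `ε / 2` for all relevant `S` at once by a union
bound over at most `2 ^ n` sets, so adaptivity is harmless too; each fails with probability at most
`1 / (2n)`. On failure the value is still non-negative, which costs the factor `1 - 1/n`. -/

/-- Double counting: pairs (`k`-set, new element) correspond to pairs (`(k + 1)`-set, marked element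
of it). -/
theorem sum_powersetCard_sum_insert {N : Type u} [DecidableEq N] (B : Finset N) (k : ℕ)
    (v : Finset N → ℝ) :
    ∑ A ∈ B.powersetCard k, ∑ x ∈ B \ A, v (insert x A) =
      (k + 1) * ∑ A ∈ B.powersetCard (k + 1), v A := by
  have h1 : ((k : ℝ) + 1) * ∑ A ∈ B.powersetCard (k + 1), v A =
      ∑ A ∈ B.powersetCard (k + 1), ∑ _x ∈ A, v A := by
    rw [Finset.mul_sum]
    refine Finset.sum_congr rfl fun A hA => ?_
    rw [Finset.sum_const, (Finset.mem_powersetCard.1 hA).2]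
    simp
  rw [h1, Finset.sum_sigma', Finset.sum_sigma']
  refine Finset.sum_bij' (fun p _ => ⟨insert p.2 p.1, p.2⟩) (fun p _ => ⟨p.1.erase p.2, p.2⟩)
    ?_ ?_ ?_ ?_ ?_
  · rintro ⟨A, x⟩ hp
    simp only [Finset.mem_sigma, Finset.mem_powersetCard, Finset.mem_sdiff] at hp ⊢
    refine ⟨⟨Finset.insert_subset hp.2.1 hp.1.1, ?_⟩, Finset.mem_insert_self _ _⟩
    rw [Finset.card_insert_of_notMem hp.2.2, hp.1.2]
  · rintro ⟨A, x⟩ hp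
    simp only [Finset.mem_sigma, Finset.mem_powersetCard, Finset.mem_sdiff] at hp ⊢
    refine ⟨⟨(Finset.erase_subset _ _).trans hp.1.1, ?_⟩, hp.1.1 hp.2, Finset.notMem_erase _ _⟩
    rw [Finset.card_erase_of_mem hp.2, hp.1.2]; rfl
  · rintro ⟨A, x⟩ hp
    simp only [Finset.mem_sigma, Finset.mem_sdiff] at hp
    simp [Finset.erase_insert hp.2.2]
  · rintro ⟨A, x⟩ hp
    simp only [Finset.mem_sigma] at hp
    simp [Finset.insert_erase hp.2]
  · rintro ⟨A, x⟩ hp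
    rfl

/-- If adding a uniform new element of `B` to `A` loses at most a fraction `1 / (|B| - |A|)` of
the value, then a uniform `k`-subset of `B` loses at most a fraction `k / |B|`. -/
theorem le_expect_powersetCard {N : Type u} [DecidableEq N] (B : Finset N) (v : Finset N → ℝ)
    (hv : ∀ A ⊆ B, ((B.card : ℝ) - A.card - 1) * v A ≤ ∑ x ∈ B \ A, v (insert x A))
    (k : ℕ) (hk : k ≤ B.card) (hB : 0 < B.card) :
    (1 - (k : ℝ) / B.card) * v ∅ ≤ 𝔼 A ∈ B.powersetCard k, v A := by
  -- The claim with denominators cleared. Passing from `k` to `k + 1` multiplies the guaranteed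
  -- average by `(b - k - 1) / (b - k)`, where `b = |B|`; the product telescopes to `(b - k) / b`.
  have key : ∀ k ≤ B.card, ((B.card : ℝ) - k) * v ∅ * (B.card.choose k : ℝ) ≤
      B.card * ∑ A ∈ B.powersetCard k, v A := by
    intro k
    induction k with
    | zero => simp
    | succ k ih =>
      intro hk
      have ih := ih (by omega)
      have hk' : ((k : ℝ) + 1) ≤ B.card := by exact_mod_cast hk
      have hstep : ((B.card : ℝ) - k - 1) * ∑ A ∈ B.powersetCard k, v A ≤
          (k + 1) * ∑ A ∈ B.powersetCard (k + 1), v A := by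
        rw [← sum_powersetCard_sum_insert, Finset.mul_sum]
        refine Finset.sum_le_sum fun A hA => ?_
        obtain ⟨hAB, hAc⟩ := Finset.mem_powersetCard.1 hA
        have := hv A hAB
        rwa [hAc] at this
      have hch : (B.card.choose (k + 1) : ℝ) * (k + 1) = B.card.choose k * (B.card - k) := by
        have := Nat.choose_succ_right_eq B.card k
        have h2 : ((B.card - k : ℕ) : ℝ) = B.card - k := Nat.cast_sub (by omega)
        rw [← h2]
        exact_mod_cast this
      have hpos : (0 : ℝ) < k + 1 := by positivity
      refine le_of_mul_le_mul_left ?_ hpos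
      push_cast
      calc ((k : ℝ) + 1) * ((B.card - (k + 1)) * v ∅ * (B.card.choose (k + 1)))
          = (B.card - k - 1) * v ∅ * (B.card.choose (k + 1) * (k + 1)) := by ring
        _ = (B.card - k - 1) * ((B.card - k) * v ∅ * B.card.choose k) := by rw [hch]; ring
        _ ≤ (B.card - k - 1) * (B.card * ∑ A ∈ B.powersetCard k, v A) :=
            mul_le_mul_of_nonneg_left ih (by linarith)
        _ = B.card * ((B.card - k - 1) * ∑ A ∈ B.powersetCard k, v A) := by ring
        _ ≤ B.card * ((k + 1) * ∑ A ∈ B.powersetCard (k + 1), v A) :=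
            mul_le_mul_of_nonneg_left hstep (by positivity)
        _ = _ := by ring
  have hB' : (0 : ℝ) < B.card := by exact_mod_cast hB
  have hc : (0 : ℝ) < B.card.choose k := by exact_mod_cast Nat.choose_pos hk
  rw [Finset.expect_eq_sum_div_card, Finset.card_powersetCard, le_div_iff₀ hc]
  refine le_of_mul_le_mul_left ?_ hB'
  refine le_trans (le_of_eq ?_) (key k hk)
  field_simp

/-! ### Submodular functions -/

theorem NonnegSubmodularOn.union_sub_le_sum {N : Type u} [DecidableEq N] {E : Set N}
    {f : Finset N → ℝ} (hf : NonnegSubmodularOn E f) (A T : Finset N) (hd : Disjoint A T)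
    (hE : ((A ∪ T : Finset N) : Set N) ⊆ E) :
    f (A ∪ T) - f A ≤ ∑ x ∈ T, (f (insert x A) - f A) := by
  induction T using Finset.induction_on with
  | empty => simp
  | insert x T hx ih =>
    rw [Finset.disjoint_insert_right] at hd
    rw [Finset.union_insert, Finset.coe_insert, Set.insert_subset_iff] at hE
    have h1 := hf.submod A (A ∪ T) Finset.subset_union_left hE.2 x hE.1 (by simp [hx, hd.1])
    have h2 := ih hd.2 hE.2
    rw [Finset.sum_insert hx, Finset.union_insert]
    linarith

/-- Remove the elements of `T` one by one: each removal loses a marginal over a subset of `S.erase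
x`, which is at least the marginal over `S.erase x` itself. -/
theorem NonnegSubmodularOn.sum_sub_erase_le {N : Type u} [DecidableEq N] {E : Set N}
    {f : Finset N → ℝ} (hf : NonnegSubmodularOn E f) (S T : Finset N) (hTS : T ⊆ S)
    (hE : (S : Set N) ⊆ E) :
    ∑ x ∈ T, (f S - f (S.erase x)) ≤ f S - f (S \ T) := by
  induction T using Finset.induction_on with
  | empty => simp
  | insert x T hx ih =>
    rw [Finset.insert_subset_iff] at hTS
    have h1 := hf.submod (S \ insert x T) (S.erase x)
      (fun y hy => by
        simp only [Finset.mem_sdiff, Finset.mem_insert, not_or, Finset.mem_erase] at hy ⊢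
        tauto)
      (fun y hy => hE (Finset.mem_of_mem_erase hy)) x (hE hTS.1) (Finset.notMem_erase _ _)
    have h2 := ih hTS.2
    have h3 : insert x (S \ insert x T) = S \ T := by
      ext y
      simp only [Finset.mem_sdiff, Finset.mem_insert, not_or]
      constructor
      · rintro (rfl | h)
        · exact ⟨hTS.1, hx⟩
        · exact ⟨h.1, h.2.2⟩
      · intro h
        by_cases hyx : y = x
        · exact Or.inl hyx
        · exact Or.inr ⟨h.1, hyx, h.2⟩
    rw [Finset.insert_erase hTS.1, h3] at h1
    rw [Finset.sum_insert hx]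
    linarith

/-- Adding a uniform `t`-subset of `H` to `S` loses at most a fraction `t / |H|` of the value. -/
theorem NonnegSubmodularOn.le_expect_union {N : Type u} [DecidableEq N] {f : Finset N → ℝ}
    (hf : NonnegSubmodularOn Set.univ f) (S H : Finset N) (hd : Disjoint S H) (t : ℕ)
    (ht : t ≤ H.card) (hH : 0 < H.card) :
    (1 - (t : ℝ) / H.card) * f S ≤ 𝔼 T ∈ H.powersetCard t, f (S ∪ T) := by
  have := le_expect_powersetCard H (fun T => f (S ∪ T)) (fun A hA => ?_) t ht hH
  · simpa using this
  · have h1 := hf.union_sub_le_sum (S ∪ A) (H \ A)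
      (Finset.disjoint_union_left.2 ⟨hd.mono_right Finset.sdiff_subset, Finset.disjoint_sdiff⟩)
      (Set.subset_univ _)
    rw [Finset.sum_sub_distrib, Finset.sum_const, Finset.card_sdiff_of_subset hA, nsmul_eq_mul,
      Nat.cast_sub (Finset.card_le_card hA)] at h1
    -- Non-negativity at the full union bounds the total loss by one copy of `f (S ∪ A)`; this is
    -- the `- 1` in the averaging hypothesis.
    have h2 := hf.nonneg (S ∪ A ∪ H \ A) (Set.subset_univ _)
    simp only [Finset.union_insert]
    linarith

/-! ### Exchange between bases and the value of contractions -/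

/-- Between any two bases there is an exchange injection: each `x` of the first base can replace
its image in the second one. -/
theorem exists_injOn_exchange {N : Type u} [Fintype N] [DecidableEq N] {M : Matroid N}
    {B₀ B : Finset N} (hB₀ : M.IsBase (B₀ : Set N)) (hB : M.IsBase (B : Set N)) :
    ∃ φ : N → N, Set.InjOn φ B₀ ∧
      (∀ x ∈ B₀, φ x ∈ B ∧ M.IsBase (insert x ((B : Set N) \ {φ x}))) ∧
      ∀ x ∈ B₀, x ∈ B → φ x = x := by
  classical
  let τ : B₀ → Finset N := fun x => {y ∈ B | M.IsBase (insert (x : N) ((B : Set N) \ {y}))}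
  -- Hall's condition by rank: `s` is independent and lies in the closure of its set `Y` of possible
  -- partners, so `|s| ≤ r(Y) ≤ |Y|`.
  have hall : ∀ s : Finset B₀, s.card ≤ (s.biUnion τ).card := by
    intro s
    have hsub : ((s.map (Function.Embedding.subtype _) : Finset N) : Set N) ⊆
        M.closure (s.biUnion τ : Finset N) := by
      intro x hx
      simp only [Finset.coe_map, Set.mem_image, Finset.mem_coe] at hx
      obtain ⟨⟨x, hxB₀⟩, hxs, rfl⟩ := hx
      simp only [Function.Embedding.subtype_apply]
      have hYB : ((s.biUnion τ : Finset N) : Set N) ⊆ B := by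
        intro y hy
        simp only [Finset.coe_biUnion, Set.mem_iUnion, Finset.mem_coe] at hy
        obtain ⟨z, _, hz⟩ := hy
        exact (Finset.mem_filter.1 hz).1
      have hYE := hYB.trans hB.subset_ground
      have hmem : ∀ y ∈ B, M.IsBase (insert x ((B : Set N) \ {y})) → y ∈ s.biUnion τ := by
        intro y hy h
        exact Finset.mem_biUnion.2 ⟨⟨x, hxB₀⟩, hxs, Finset.mem_filter.2 ⟨hy, h⟩⟩
      by_cases hxB : x ∈ B
      · refine M.subset_closure _ hYE ?_
        refine hmem x hxB ?_
        rw [Set.insert_sdiff_singleton, Set.insert_eq_of_mem (by exact_mod_cast hxB)]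
        exact hB
      · by_contra hcl
        -- If `x` were outside the closure of `Y`, then `Y + x` would extend to a basis `B'` inside
        -- `B + x`. An element `y` of `B` missing from `B'` can be exchanged only for `x`, so `y` is
        -- a partner of `x` and lies in `Y ⊆ B'`, a contradiction.
        have hYi : M.Indep ((s.biUnion τ : Finset N) : Set N) := hB.indep.subset hYB
        have hins : M.Indep (insert x ((s.biUnion τ : Finset N) : Set N)) := by
          rw [hYi.insert_indep_iff]
          exact Or.inl ⟨hB₀.subset_ground hxB₀, hcl⟩
        obtain ⟨B', hB', hsub1, hsub2⟩ := hins.exists_isBase_subset_union_isBase hB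
        have hB'sub : B' ⊆ insert x (B : Set N) := hsub2.trans
          (Set.union_subset (Set.insert_subset_insert hYB) (Set.subset_insert _ _))
        have hxB' : x ∈ B' := hsub1 (Set.mem_insert _ _)
        obtain ⟨y, hyB, hyB'⟩ : ∃ y ∈ (B : Set N), y ∉ B' := by
          by_contra hcon
          push Not at hcon
          have := hB.eq_of_subset_isBase hB' hcon
          exact hxB (by rw [← this] at hxB'; exact_mod_cast hxB')
        obtain ⟨z, hz, hzb⟩ := hB.exchange hB' ⟨hyB, hyB'⟩
        have hzx : z = x := by
          rcases hB'sub hz.1 with h | h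
          · exact h
          · exact absurd h hz.2
        subst hzx
        exact hyB' (hsub1 (Set.mem_insert_of_mem _ (hmem y hyB hzb)))
    have hsi : M.Indep ((s.map (Function.Embedding.subtype _) : Finset N) : Set N) := by
      refine hB₀.indep.subset ?_
      intro x hx
      simp only [Finset.coe_map, Set.mem_image, Finset.mem_coe] at hx
      obtain ⟨⟨x, hxB₀⟩, _, rfl⟩ := hx
      exact hxB₀
    have h1 := hsi.encard_le_eRk_of_subset hsub
    rw [Matroid.eRk_closure_eq] at h1
    have h2 := h1.trans (M.eRk_le_encard _)
    rw [Set.encard_coe_eq_coe_finsetCard, Set.encard_coe_eq_coe_finsetCard, Finset.card_map] at h2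
    exact_mod_cast h2
  obtain ⟨g, hg, hgτ⟩ := (Finset.all_card_le_biUnion_card_iff_exists_injective τ).1 hall
  have hg' : ∀ x : B₀, g x ∈ B ∧ M.IsBase (insert (x : N) ((B : Set N) \ {g x})) :=
    fun x => Finset.mem_filter.1 (hgτ x)
  refine ⟨fun x => if hx : x ∈ B₀ then g ⟨x, hx⟩ else x, ?_, ?_, ?_⟩
  · intro x hx y hy hxy
    simp only [Finset.mem_coe] at hx hy
    simp only [hx, hy, dite_true] at hxy
    simpa using hg hxy
  · intro x hx
    simp only [hx, dite_true]
    exact hg' ⟨x, hx⟩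
  · intro x hx hxB
    simp only [hx, dite_true]
    obtain ⟨h1, h2⟩ := hg' ⟨x, hx⟩
    -- For `x ∈ B` the exchanged basis is contained in `B`, hence equals it, so the removed element
    -- must be `x` itself.
    by_contra hne
    have hsub : insert x ((B : Set N) \ {g ⟨x, hx⟩}) ⊆ B :=
      Set.insert_subset (by exact_mod_cast hxB) Set.sdiff_subset
    have heq := h2.eq_of_subset_isBase hB hsub
    have : g ⟨x, hx⟩ ∈ insert x ((B : Set N) \ {g ⟨x, hx⟩}) := by
      rw [heq]; exact_mod_cast h1
    rcases this with h | h
    · exact hne h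
    · exact h.2 rfl

/-- The largest value of `f` on an independent set of the contraction of `M` by `H`. -/
noncomputable def contractValue {N : Type u} (M : Matroid N) (f : Finset N → ℝ) (H : Finset N) : ℝ :=
  ⨆ S : {S : Finset N // (M ／ (H : Set N)).Indep (S : Set N)}, f S

theorem exists_eq_contractValue {N : Type u} [Fintype N] (M : Matroid N) (f : Finset N → ℝ)
    (H : Finset N) :
    ∃ S : Finset N, (M ／ (H : Set N)).Indep (S : Set N) ∧ f S = contractValue M f H := by
  have : Nonempty {S : Finset N // (M ／ (H : Set N)).Indep (S : Set N)} :=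
    ⟨⟨∅, by simp⟩⟩
  obtain ⟨S, hS⟩ := exists_eq_ciSup_of_finite
    (f := fun S : {S : Finset N // (M ／ (H : Set N)).Indep (S : Set N)} => f S)
  exact ⟨S, S.2, hS⟩

theorem le_contractValue {N : Type u} [Fintype N] (M : Matroid N) (f : Finset N → ℝ)
    (H S : Finset N) (hS : (M ／ (H : Set N)).Indep (S : Set N)) :
    f S ≤ contractValue M f H :=
  le_ciSup (f := fun S : {S : Finset N // (M ／ (H : Set N)).Indep (S : Set N)} => f S)
    (Set.finite_range _).bddAbove ⟨S, hS⟩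

/-- Extend `S ∪ A`, with `S` optimal after contracting `A`, to a basis and take the exchange
injection `φ`. Then `S.erase (φ x)` is feasible after contracting `x` as well, and since the `φ x`
are distinct, submodularity bounds the sum of the losses by `f S`. -/
theorem contractValue_step {N : Type u} [Fintype N] [DecidableEq N] {f : Finset N → ℝ}
    (hf : NonnegSubmodularOn Set.univ f) {M : Matroid N} {B₀ : Finset N}
    (hB₀ : M.IsBase (B₀ : Set N)) (A : Finset N) (hA : A ⊆ B₀) :
    ((B₀.card : ℝ) - A.card - 1) * contractValue M f A ≤
      ∑ x ∈ B₀ \ A, contractValue M f (insert x A) := by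
  obtain ⟨S, hS, hSv⟩ := exists_eq_contractValue M f A
  have hAi : M.Indep (A : Set N) := hB₀.indep.subset (by exact_mod_cast hA)
  rw [hAi.contract_indep_iff] at hS
  obtain ⟨B, hB, hSB⟩ := hS.2.exists_isBase_superset
  obtain ⟨B, rfl⟩ : ∃ B' : Finset N, (B' : Set N) = B := ⟨B.toFinite.toFinset, by simp⟩
  obtain ⟨φ, hinj, hφ, hfix⟩ := exists_injOn_exchange hB₀ hB
  have hfixA : ∀ y ∈ A, φ y = y := fun y hy =>
    hfix y (hA hy) (by exact_mod_cast hSB (Or.inr (by exact_mod_cast hy)))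
  have hstep : ∀ x ∈ B₀ \ A, f (S.erase (φ x)) ≤ contractValue M f (insert x A) := by
    intro x hx
    rw [Finset.mem_sdiff] at hx
    refine le_contractValue M f _ _ ?_
    have hbase := (hφ x hx.1).2
    -- The exchange never removes an element of `A`: `φ` fixes `A`, and by injectivity `φ x ∉ A`
    -- when `x ∉ A`.
    have hxA : insert x (A : Set N) ⊆ insert x ((B : Set N) \ {φ x}) := by
      refine Set.insert_subset_insert fun y hy => ⟨hSB (Or.inr hy), fun hyx => ?_⟩
      simp only [Set.mem_singleton_iff] at hyx
      rw [← hfixA y hy] at hyx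
      exact hx.2 (hinj (hA hy) hx.1 hyx ▸ hy)
    rw [Finset.coe_insert, (hbase.indep.subset hxA).contract_indep_iff]
    constructor
    · rw [Set.disjoint_insert_right]
      constructor
      · intro hxS
        simp only [Finset.coe_erase, Set.mem_sdiff, Finset.mem_coe, Set.mem_singleton_iff] at hxS
        exact hxS.2 (hfix x hx.1 (by exact_mod_cast hSB (Or.inl hxS.1))).symm
      · exact hS.1.mono_left (by exact_mod_cast Finset.erase_subset _ _)
    · refine hbase.indep.subset (Set.union_subset ?_ hxA)
      intro y hy
      simp only [Finset.coe_erase, Set.mem_sdiff, Finset.mem_coe, Set.mem_singleton_iff] at hy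
      exact Or.inr ⟨hSB (Or.inl hy.1), hy.2⟩
  refine le_trans ?_ (Finset.sum_le_sum hstep)
  have hloss : ∑ x ∈ B₀ \ A, (f S - f (S.erase (φ x))) ≤ f S := by
    have himg : ∑ x ∈ B₀ \ A, (f S - f (S.erase (φ x))) =
        ∑ y ∈ (B₀ \ A).image φ, (f S - f (S.erase y)) := by
      rw [Finset.sum_image]
      exact hinj.mono (by exact_mod_cast Finset.sdiff_subset)
    -- Partners outside `S` cost nothing.
    have hfilt : ∑ y ∈ (B₀ \ A).image φ, (f S - f (S.erase y)) =
        ∑ y ∈ (B₀ \ A).image φ with y ∈ S, (f S - f (S.erase y)) := by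
      refine (Finset.sum_filter_of_ne fun y _ hne => ?_).symm
      by_contra hy
      exact hne (by rw [Finset.erase_eq_of_notMem hy, sub_self])
    rw [himg, hfilt]
    have h1 := hf.sum_sub_erase_le S {y ∈ (B₀ \ A).image φ | y ∈ S}
      (fun y hy => (Finset.mem_filter.1 hy).2) (Set.subset_univ _)
    have h2 := hf.nonneg (S \ {y ∈ (B₀ \ A).image φ | y ∈ S}) (Set.subset_univ _)
    linarith
  rw [Finset.sum_sub_distrib, Finset.sum_const, Finset.card_sdiff_of_subset hA, nsmul_eq_mul,
    Nat.cast_sub (Finset.card_le_card hA)] at hloss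
  rw [← hSv]
  linarith

/-- Contracting by a uniform `h`-subset of a basis loses at most a fraction `h / r` of the
optimal value. -/
theorem le_expect_contractValue {N : Type u} [Fintype N] [DecidableEq N] {f : Finset N → ℝ}
    (hf : NonnegSubmodularOn Set.univ f) {M : Matroid N} {B₀ : Finset N}
    (hB₀ : M.IsBase (B₀ : Set N)) {O : Finset N} (hO : M.Indep (O : Set N)) (h : ℕ)
    (hh : h < B₀.card) :
    (1 - (h : ℝ) / B₀.card) * f O ≤ 𝔼 H ∈ B₀.powersetCard h, contractValue M f H := by
  refine le_trans ?_ (le_expect_powersetCard B₀ (contractValue M f)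
    (fun A hA => contractValue_step hf hB₀ A hA) h hh.le (by omega))
  refine mul_le_mul_of_nonneg_left (le_contractValue M f ∅ O (by simpa using hO)) ?_
  rw [sub_nonneg]
  exact div_le_one_of_le₀ (by exact_mod_cast hh.le) (by positivity)

/-! ### Running the smoothed program -/

namespace QueryProg

theorem run_querySum {N : Type u} (g : Finset N → ℝ) (L : List (Finset N)) (acc : ℝ)
    (k : ℝ → QueryProg N) :
    (querySum L acc k).run g = (k (acc + (L.map g).sum)).run g := by
  induction L generalizing acc with
  | nil => simp [querySum]
  | cons S L ih => simp [querySum, run, ih, add_assoc]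

theorem queries_querySum {N : Type u} (g : Finset N → ℝ) (L : List (Finset N)) (acc : ℝ)
    (k : ℝ → QueryProg N) :
    (querySum L acc k).queries g = L ++ (k (acc + (L.map g).sum)).queries g := by
  induction L generalizing acc with
  | nil => simp [querySum]
  | cons S L ih => simp [querySum, queries, ih, add_assoc]

theorem sum_map_ofFn_div {N : Type u} [DecidableEq N] {m : ℕ} (Hs : Fin m → Finset N)
    (g : Finset N → ℝ) (S : Finset N) :
    (0 + ((List.ofFn fun i => S ∪ Hs i).map g).sum) / m = sampleAverage g Hs S := by
  rw [zero_add, List.map_ofFn, List.sum_ofFn]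
  rfl

theorem run_smooth {N : Type u} [DecidableEq N] {m : ℕ} (Hs : Fin m → Finset N) (H' : Finset N)
    (g : Finset N → ℝ) (p : QueryProg N) :
    (p.smooth Hs H').run g = p.run (sampleAverage g Hs) ∪ H' := by
  induction p with
  | ret S => rfl
  | query S k ih => rw [smooth, run_querySum, sum_map_ofFn_div, ih, run]

theorem numQueries_smooth {N : Type u} [DecidableEq N] {m : ℕ} (Hs : Fin m → Finset N)
    (H' : Finset N) (g : Finset N → ℝ) (p : QueryProg N) :
    (p.smooth Hs H').numQueries g = m * p.numQueries (sampleAverage g Hs) := by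
  induction p with
  | ret S => rfl
  | query S k ih =>
    unfold numQueries at ih ⊢
    rw [smooth, queries_querySum, sum_map_ofFn_div, List.length_append, ih, queries,
      List.length_ofFn, List.length_cons]
    ring

end QueryProg

theorem metaQueryComplexity_le {N : Type u} [DecidableEq N] (A : Algorithm.{u, v} N)
    (M : Matroid N) (B₀ : Finset N) (h t m : ℕ) (𝓜 : Set (Matroid N))
    (h𝓜 : ∀ H ∈ B₀.powersetCard h, M ／ (H : Set N) ∈ 𝓜) :
    metaQueryComplexity A M B₀ h t m ≤ m * A.queryComplexity 𝓜 := by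
  unfold metaQueryComplexity
  refine iSup₂_le fun H hH => iSup₂_le fun Hs _ => iSup₂_le fun H' _ => iSup_le fun s =>
    iSup_le fun g => ?_
  rw [metaProg, QueryProg.numQueries_smooth, Nat.cast_mul]
  refine mul_le_mul_right ?_ _
  unfold Algorithm.queryComplexity
  exact le_iSup₂_of_le (M ／ (H : Set N)) (h𝓜 H hH)
    (le_iSup₂_of_le s (sampleAverage g Hs) le_rfl)

theorem indep_run_metaProg {N : Type u} [DecidableEq N] (A : Algorithm.{u, v} N) (M : Matroid N)
    {m : ℕ} {H : Finset N} (hH : M.Indep (H : Set N)) (Hs : Fin m → Finset N) {H' : Finset N}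
    (hH' : H' ⊆ H) (s : A.Seed) (g : Finset N → ℝ) :
    M.Indep ((metaProg A M H Hs H' s).run g : Set N) := by
  rw [metaProg, QueryProg.run_smooth]
  have h1 := A.indep_run (M ／ (H : Set N)) s (sampleAverage g Hs)
  rw [hH.contract_indep_iff] at h1
  refine h1.2.subset ?_
  rw [Finset.coe_union]
  exact Set.union_subset_union_right _ (by exact_mod_cast hH')

/-! ### The parameters -/

/-- Induction through `(n + 1) * n.choose k = (n + 1).choose (k + 1) * (k + 1)`, with `q * (k + 1) ≤
n + 1` supplying the new factor `q`. -/
theorem pow_le_choose_of_mul_le (q k : ℕ) : ∀ n, q * k ≤ n → q ^ k ≤ n.choose k := by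
  induction k with
  | zero => simp
  | succ k ih =>
    intro n hn
    rcases Nat.eq_zero_or_pos q with rfl | hq
    · simp
    · obtain ⟨n, rfl⟩ : ∃ n', n = n' + 1 := ⟨n - 1, by rw [mul_add] at hn; omega⟩
      have h1 := ih n (by rw [mul_add] at hn; omega)
      refine Nat.le_of_mul_le_mul_right ?_ (Nat.succ_pos k)
      rw [Nat.succ_eq_add_one, ← Nat.add_one_mul_choose_eq]
      calc q ^ (k + 1) * (k + 1) = q * (k + 1) * q ^ k := by ring
        _ ≤ (n + 1) * n.choose k := Nat.mul_le_mul hn h1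

theorem ParamCondition.pos {n : ℕ} {ν fmax ε : ℝ} {h t m : ℕ}
    (hpar : ParamCondition n ν fmax ε (1 / n) h t m) (hn : 0 < n) (hf : 0 < fmax) (hε : 0 < ε) :
    0 < m := by
  have h1 := hpar.1
  have hn1 : (1 : ℝ) ≤ n := by exact_mod_cast hn
  have hlog : 0 ≤ Real.log (4 / (1 / (n : ℝ))) := by
    refine Real.log_nonneg ?_
    rw [one_div, div_inv_eq_mul]
    linarith
  have h2 : 0 < max 2 (8 * ν ^ 2) * (fmax ^ 2 / ε ^ 2) * (n + Real.log (4 / (1 / (n : ℝ)))) := by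
    have : (0 : ℝ) < max 2 (8 * ν ^ 2) := lt_of_lt_of_le (by norm_num) (le_max_left _ _)
    positivity
  exact_mod_cast h2.trans_le h1

theorem ParamCondition.four_mul_le {n : ℕ} {ν fmax ε δ : ℝ} {h t m : ℕ}
    (hpar : ParamCondition n ν fmax ε δ h t m) (hm : 0 < m) : 4 * m ≤ 2 ^ t := by
  have h1 := hpar.2.1
  have hm' : (0 : ℝ) < m := by exact_mod_cast hm
  rw [Real.logb_le_iff_le_rpow (by norm_num) (by positivity), Real.rpow_natCast] at h1
  exact_mod_cast h1

theorem ParamCondition.two_le {n : ℕ} {ν fmax ε δ : ℝ} {h t m : ℕ}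
    (hpar : ParamCondition n ν fmax ε δ h t m) (hm : 0 < m) : 2 ≤ t := by
  have h1 := hpar.four_mul_le hm
  by_contra hlt
  have : t = 0 ∨ t = 1 := by omega
  rcases this with rfl | rfl <;> omega

theorem ParamCondition.lt {n : ℕ} {ν fmax ε δ : ℝ} {h t m : ℕ}
    (hpar : ParamCondition n ν fmax ε δ h t m) (hm : 0 < m) : t < h := by
  have h2 := hpar.two_le hm
  rw [hpar.2.2]
  nlinarith

/-- The choice `h = t ^ 2` makes `H` have at least `t ^ t ≥ 2 ^ t` subsets of size `t`, enough for
`m` distinct samples. -/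
theorem ParamCondition.le_choose {n : ℕ} {ν fmax ε δ : ℝ} {h t m : ℕ}
    (hpar : ParamCondition n ν fmax ε δ h t m) (hm : 0 < m) : m ≤ h.choose t := by
  have h1 := hpar.four_mul_le hm
  calc m ≤ 2 ^ t := by omega
    _ ≤ t ^ t := Nat.pow_le_pow_left (hpar.two_le hm) t
    _ ≤ h.choose t := pow_le_choose_of_mul_le t t h (by rw [hpar.2.2, sq])

/-! ### Sampling without replacement -/

/-- The `m`-tuples of distinct elements of `s`. -/
def injTuples {α : Type u} [DecidableEq α] (s : Finset α) (m : ℕ) : Finset (Fin m → α) :=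
  {x ∈ Fintype.piFinset fun _ : Fin m => s | ∀ i j, x i = x j → i = j}

theorem mem_injTuples {α : Type u} [DecidableEq α] {s : Finset α} {m : ℕ} {x : Fin m → α} :
    x ∈ injTuples s m ↔ (∀ i, x i ∈ s) ∧ Function.Injective x := by
  simp only [injTuples, Finset.mem_filter, Fintype.mem_piFinset]
  rfl

theorem samples_eq_injTuples {N : Type u} [DecidableEq N] (H : Finset N) (t m : ℕ) :
    samples H t m = injTuples (H.powersetCard t) m := rfl

/-- Conditioning on the first draw: the rest is a sample without replacement from the remaining
elements. -/
theorem sum_injTuples_succ {α : Type u} [DecidableEq α] (s : Finset α) (m : ℕ)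
    (F : (Fin (m + 1) → α) → ℝ) :
    ∑ x ∈ injTuples s (m + 1), F x =
      ∑ j ∈ s, ∑ y ∈ injTuples (s.erase j) m, F (Fin.cons j y) := by
  rw [Finset.sum_sigma']
  refine Finset.sum_bij' (fun x _ => ⟨x 0, Fin.tail x⟩) (fun p _ => Fin.cons p.1 p.2) ?_ ?_ ?_ ?_ ?_
  · intro x hx
    rw [mem_injTuples] at hx
    simp only [Finset.mem_sigma, mem_injTuples, Finset.mem_erase, Fin.tail]
    refine ⟨hx.1 0, fun i => ⟨fun h => ?_, hx.1 _⟩, hx.2.comp (Fin.succ_injective _)⟩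
    exact Fin.succ_ne_zero i (hx.2 h)
  · rintro ⟨j, y⟩ hp
    simp only [Finset.mem_sigma, mem_injTuples, Finset.mem_erase] at hp
    rw [mem_injTuples, Fin.cons_injective_iff]
    refine ⟨fun i => ?_, ?_, hp.2.2⟩
    · refine Fin.cases ?_ (fun i => ?_) i
      · simpa using hp.1
      · simpa using (hp.2.1 i).2
    · rintro ⟨i, hi⟩
      exact (hp.2.1 i).1 hi
  · intro x _
    exact Fin.cons_self_tail x
  · rintro ⟨j, y⟩ _
    simp
  · intro x _
    simp

theorem card_injTuples {α : Type u} [DecidableEq α] (m : ℕ) :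
    ∀ s : Finset α, (injTuples s m).card = s.card.descFactorial m := by
  induction m with
  | zero =>
    intro s
    rw [Nat.descFactorial_zero, Finset.card_eq_one]
    refine ⟨Fin.elim0, ?_⟩
    ext x
    simp only [mem_injTuples, Finset.mem_singleton]
    exact ⟨fun _ => Subsingleton.elim _ _,
      fun _ => ⟨fun i => i.elim0, Function.injective_of_subsingleton _⟩⟩
  | succ m ih =>
    intro s
    have h1 := sum_injTuples_succ s m (fun _ => 1)
    simp only [Finset.sum_const, nsmul_eq_mul, mul_one, ih] at h1
    rw [Finset.sum_congr rfl fun j hj => by rw [Finset.card_erase_of_mem hj], Finset.sum_const,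
      nsmul_eq_mul] at h1
    have h2 : (injTuples s (m + 1)).card = s.card * (s.card - 1).descFactorial m := by
      exact_mod_cast h1
    rw [h2]
    rcases Nat.eq_zero_or_pos s.card with h0 | h0
    · simp [h0]
    · obtain ⟨k, hk⟩ : ∃ k, s.card = k + 1 := ⟨s.card - 1, by omega⟩
      rw [hk, Nat.succ_descFactorial_succ]
      rfl

theorem injTuples_nonempty {α : Type u} [DecidableEq α] {s : Finset α} {m : ℕ}
    (hm : m ≤ s.card) : (injTuples s m).Nonempty := by
  rw [← Finset.card_pos, card_injTuples]
  exact Nat.descFactorial_pos.2 hm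

/-- Hoeffding's lemma for the uniform distribution on a finite set. -/
theorem sum_exp_sub_mean_le {α : Type u} (s : Finset α) (hs : s.Nonempty) (x : α → ℝ) {R : ℝ}
    (hx : ∀ j ∈ s, x j ∈ Set.Icc 0 R) (l : ℝ) :
    ∑ j ∈ s, Real.exp (l * (x j - (∑ k ∈ s, x k) / s.card)) ≤
      s.card * Real.exp (l ^ 2 * R ^ 2 / 8) := by
  let : MeasurableSpace s := ⊤
  have : Nonempty s := hs.to_subtype
  have hint : ∀ F : s → ℝ, ∫ j, F j ∂(PMF.uniformOfFintype s).toMeasure =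
      (∑ j : s, F j) / s.card := by
    intro F
    rw [PMF.integral_eq_sum, Finset.sum_div]
    refine Finset.sum_congr rfl fun j _ => ?_
    simp [PMF.uniformOfFintype_apply, div_eq_inv_mul]
  have h := hasSubgaussianMGF_of_mem_Icc (μ := (PMF.uniformOfFintype s).toMeasure)
    (X := fun j : s => x j) (a := 0) (b := R) (measurable_of_finite _).aemeasurable
    (Filter.Eventually.of_forall fun j => hx j j.2)
  have h2 := h.mgf_le l
  rw [mgf, hint, hint, Finset.sum_coe_sort s x,
    Finset.sum_coe_sort s fun j => Real.exp (l * (x j - (∑ k ∈ s, x k) / s.card)),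
    div_le_iff₀ (by exact_mod_cast hs.card_pos)] at h2
  refine h2.trans (le_of_eq ?_)
  rw [mul_comm]
  congr 2
  push_cast
  rw [sub_zero, div_pow, Real.norm_eq_abs, sq_abs]
  ring

/-- Hoeffding's bound on the moment generating function of a sum of `m` values sampled without
replacement. -/
theorem sum_injTuples_exp_le {α : Type u} [DecidableEq α] (x : α → ℝ) {R : ℝ} (l : ℝ) (m : ℕ) :
    ∀ s : Finset α, m ≤ s.card → (∀ j ∈ s, x j ∈ Set.Icc 0 R) →
    ∑ y ∈ injTuples s m, Real.exp (l * (∑ i, x (y i) - m * ((∑ k ∈ s, x k) / s.card))) ≤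
      (injTuples s m).card * Real.exp (m * (l ^ 2 * R ^ 2 / 8)) := by
  induction m with
  | zero => intro s _ _; simp
  | succ m ih =>
    intro s hm hx
    have hs : s.Nonempty := Finset.card_pos.1 (by omega)
    have hspos : (0 : ℝ) < s.card := by exact_mod_cast hs.card_pos
    set μ := (∑ k ∈ s, x k) / s.card with hμ
    -- Drawing `j` first shifts the mean of the remaining elements, so the deviation of the whole
    -- sample is `c * (x j - μ)` plus the deviation of the rest from its own mean. As `0 ≤ c ≤ 1`,
    -- the first draw contributes no more than with replacement.
    set c : ℝ := 1 - m / (s.card - 1) with hc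
    have hs1 : (m : ℝ) ≤ s.card - 1 := by
      have : ((m + 1 : ℕ) : ℝ) ≤ s.card := by exact_mod_cast hm
      push_cast at this
      linarith
    have hm0 : (0 : ℝ) ≤ m := by positivity
    have hc0 : 0 ≤ c := by
      rw [hc, sub_nonneg]
      exact div_le_one_of_le₀ hs1 (hm0.trans hs1)
    have hc1 : c ≤ 1 := by
      rw [hc, sub_le_self_iff]
      exact div_nonneg hm0 (hm0.trans hs1)
    have hinner : ∀ j ∈ s, ∑ y ∈ injTuples (s.erase j) m,
        Real.exp (l * (∑ i, x ((Fin.cons j y : Fin (m + 1) → α) i) - (m + 1 : ℕ) * μ)) ≤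
        Real.exp (l * c * (x j - μ)) *
          ((s.card - 1).descFactorial m * Real.exp (m * (l ^ 2 * R ^ 2 / 8))) := by
      intro j hj
      have hcard := Finset.card_erase_of_mem hj
      have h1 := ih (s.erase j) (by omega) fun k hk => hx k (Finset.mem_of_mem_erase hk)
      rw [card_injTuples, hcard] at h1
      refine le_trans (le_of_eq ?_) (mul_le_mul_of_nonneg_left h1 (Real.exp_nonneg _))
      rw [Finset.mul_sum]
      refine Finset.sum_congr rfl fun y _ => ?_
      rw [← Real.exp_add, Fin.sum_univ_succ]
      congr 1
      simp only [Fin.cons_zero, Fin.cons_succ]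
      have hsum : ∑ k ∈ s.erase j, x k = s.card * μ - x j := by
        rw [Finset.sum_erase_eq_sub hj, hμ]
        field_simp
      have hcast : ((s.card - 1 : ℕ) : ℝ) = s.card - 1 := by
        rw [Nat.cast_sub (by omega)]; simp
      rw [hsum, hcast, hc]
      -- For `m = 0` the set may be a singleton and `s.card - 1` vanish; otherwise it can be
      -- cancelled.
      rcases Nat.eq_zero_or_pos m with rfl | hmpos
      · simp
      · have hmpos' : (0 : ℝ) < m := by exact_mod_cast hmpos
        have : (s.card : ℝ) - 1 ≠ 0 := by linarith
        push_cast
        field_simp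
        ring
    rw [sum_injTuples_succ]
    refine (Finset.sum_le_sum hinner).trans ?_
    rw [← Finset.sum_mul]
    have hH := sum_exp_sub_mean_le s hs x hx (l * c)
    rw [← hμ] at hH
    have hexp : Real.exp ((l * c) ^ 2 * R ^ 2 / 8) ≤ Real.exp (l ^ 2 * R ^ 2 / 8) := by
      refine Real.exp_le_exp.2 ?_
      have : c ^ 2 ≤ 1 := by nlinarith
      have h3 : 0 ≤ l ^ 2 * R ^ 2 := by positivity
      nlinarith
    have hcardeq : ((injTuples s (m + 1)).card : ℝ) = s.card * (s.card - 1).descFactorial m := by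
      rw [card_injTuples]
      obtain ⟨k, hk⟩ : ∃ k, s.card = k + 1 := ⟨s.card - 1, by omega⟩
      rw [hk, Nat.succ_descFactorial_succ]
      push_cast
      rfl
    calc (∑ j ∈ s, Real.exp (l * c * (x j - μ))) *
          ((s.card - 1).descFactorial m * Real.exp (m * (l ^ 2 * R ^ 2 / 8)))
        ≤ (s.card * Real.exp (l ^ 2 * R ^ 2 / 8)) *
          ((s.card - 1).descFactorial m * Real.exp (m * (l ^ 2 * R ^ 2 / 8))) := by
          refine mul_le_mul_of_nonneg_right (hH.trans ?_) (by positivity)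
          exact mul_le_mul_of_nonneg_left hexp hspos.le
      _ = _ := by
          rw [hcardeq]
          push_cast
          rw [show ((m : ℝ) + 1) * (l ^ 2 * R ^ 2 / 8) =
            l ^ 2 * R ^ 2 / 8 + m * (l ^ 2 * R ^ 2 / 8) by ring, Real.exp_add]
          ring

/-- Hoeffding's inequality for sampling without replacement. -/
theorem card_injTuples_abs_ge_le {α : Type u} [DecidableEq α] (x : α → ℝ) {R η : ℝ} (hR : 0 < R)
    (hη : 0 < η) (m : ℕ) (s : Finset α) (hm : m ≤ s.card) (hx : ∀ j ∈ s, x j ∈ Set.Icc 0 R) :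
    (({y ∈ injTuples s m | m * η ≤ |∑ i, x (y i) - m * ((∑ k ∈ s, x k) / s.card)|}).card : ℝ) ≤
      (injTuples s m).card * (2 * Real.exp (-(2 * m * η ^ 2 / R ^ 2))) := by
  set d : (Fin m → α) → ℝ := fun y => ∑ i, x (y i) - m * ((∑ k ∈ s, x k) / s.card) with hd
  -- The minimizer of `m * l ^ 2 * R ^ 2 / 8 - l * m * η`.
  set l : ℝ := 4 * η / R ^ 2 with hl
  have hlpos : 0 < l := by positivity
  have hbound : ∀ l' : ℝ, l' ^ 2 = l ^ 2 →
      ∑ y ∈ injTuples s m, Real.exp (l' * d y - l * (m * η)) ≤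
        (injTuples s m).card * Real.exp (-(2 * m * η ^ 2 / R ^ 2)) := by
    intro l' hl'
    have h1 := sum_injTuples_exp_le x l' m s hm hx
    simp_rw [Real.exp_sub]
    rw [← Finset.sum_div, div_le_iff₀ (Real.exp_pos _), mul_assoc, ← Real.exp_add]
    refine h1.trans (le_of_eq ?_)
    congr 2
    rw [hl', hl]
    field_simp
    ring
  have hpt : ∀ y ∈ injTuples s m, (if m * η ≤ |d y| then (1 : ℝ) else 0) ≤
      Real.exp (l * d y - l * (m * η)) + Real.exp (-l * d y - l * (m * η)) := by
    intro y _
    split_ifs with hy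
    · rcases le_abs.1 hy with h | h
      · have : 1 ≤ Real.exp (l * d y - l * (m * η)) := Real.one_le_exp (by nlinarith)
        linarith [Real.exp_pos (-l * d y - l * (m * η))]
      · have : 1 ≤ Real.exp (-l * d y - l * (m * η)) := Real.one_le_exp (by nlinarith)
        linarith [Real.exp_pos (l * d y - l * (m * η))]
    · positivity
  rw [Finset.card_filter]
  push_cast
  refine (Finset.sum_le_sum hpt).trans ?_
  rw [Finset.sum_add_distrib]
  have := hbound l rfl
  have := hbound (-l) (by ring)
  linarith

/-! ### Concentration of the noise -/

theorem IsNoise.mgf_le {N : Type u} {Ω : Type w} [MeasurableSpace Ω] {P : Measure Ω}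
    {ξ : Finset N → Ω → ℝ} {D : Measure ℝ} (hξ : IsNoise P ξ D) {ν a : ℝ}
    (hD : IsSubExponential D ν a) (T : Finset N) (c l : ℝ) (hl : |l * c| * a ≤ 1) :
    Integrable (fun ω => Real.exp (l * (c * (ξ T ω - 1)))) P ∧
      mgf (fun ω => c * (ξ T ω - 1)) P l ≤ Real.exp (ν ^ 2 * (l * c) ^ 2 / 2) := by
  obtain ⟨h1, h2⟩ := hD (l * c) hl
  rw [hξ.unbiased] at h1 h2
  have hm : AEMeasurable (ξ T) P := (hξ.measurable T).aemeasurable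
  rw [← hξ.law T] at h1 h2
  have hmeas : Measurable fun x : ℝ => Real.exp (l * c * (x - 1)) := by fun_prop
  rw [integrable_map_measure hmeas.aestronglyMeasurable hm] at h1
  rw [integral_map hm hmeas.aestronglyMeasurable] at h2
  have heq : ∀ ω, l * (c * (ξ T ω - 1)) = l * c * (ξ T ω - 1) := fun ω => by ring
  simp only [mgf, heq]
  exact ⟨h1, h2⟩

/-- Chernoff's bound for a weighted sum of independent sub-exponential multipliers. -/
theorem IsNoise.measureReal_abs_sum_ge_le {N : Type u} {Ω : Type w} [MeasurableSpace Ω]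
    {P : Measure Ω} [IsProbabilityMeasure P] {ξ : Finset N → Ω → ℝ} {D : Measure ℝ}
    (hξ : IsNoise P ξ D) {ν a : ℝ} (ha : 0 ≤ a) (hD : IsSubExponential D ν a) {m : ℕ}
    {T : Fin m → Finset N} (hT : Function.Injective T) (c : Fin m → ℝ) {R η : ℝ} (hR : 0 < R)
    (hν : 0 < ν ^ 2) (hη : 0 < η) (hηa : η * a ≤ ν ^ 2 * R) (hc : ∀ i, c i ∈ Set.Icc 0 R) :
    P.real {ω | m * η ≤ |∑ i, c i * (ξ (T i) ω - 1)|} ≤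
      2 * Real.exp (-(m * η ^ 2 / (2 * ν ^ 2 * R ^ 2))) := by
  set X : Fin m → Ω → ℝ := fun i ω => c i * (ξ (T i) ω - 1) with hX
  have hXm : ∀ i, Measurable (X i) := fun i => ((hξ.measurable (T i)).sub_const 1).const_mul _
  have hXi : iIndepFun X P :=
    (hξ.indep.precomp hT).comp (fun i x => c i * (x - 1)) fun i => by fun_prop
  -- The minimizer of `m * ν ^ 2 * (l * R) ^ 2 / 2 - l * m * η`. The assumption `η * a ≤ ν ^ 2 * R`
  -- says exactly that `l * R` is in the range of the sub-exponential bound.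
  set l : ℝ := η / (ν ^ 2 * R ^ 2) with hl
  have hlpos : 0 < l := by positivity
  have hlR : l * R * a ≤ 1 := by
    have : l * R * a = η * a / (ν ^ 2 * R) := by
      rw [hl]; field_simp
    rw [this]
    exact div_le_one_of_le₀ hηa (by positivity)
  have hcond : ∀ l' : ℝ, |l'| = l → ∀ i, |l' * c i| * a ≤ 1 := by
    intro l' hl' i
    rw [abs_mul, hl', abs_of_nonneg (hc i).1]
    refine le_trans ?_ hlR
    exact mul_le_mul_of_nonneg_right (mul_le_mul_of_nonneg_left (hc i).2 hlpos.le) ha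
  have hmgf : ∀ l' : ℝ, |l'| = l → Real.exp (-l * (m * η)) * mgf (∑ i, X i) P l' ≤
      Real.exp (-(m * η ^ 2 / (2 * ν ^ 2 * R ^ 2))) := by
    intro l' hl'
    have h1 : mgf (∑ i, X i) P l' ≤ Real.exp (m * (ν ^ 2 * (l * R) ^ 2 / 2)) := by
      rw [hXi.mgf_sum hXm, Real.exp_nat_mul]
      refine (Finset.prod_le_prod (fun i _ => mgf_nonneg) fun i _ =>
        ((hξ.mgf_le hD (T i) (c i) l' (hcond l' hl' i)).2.trans
          (Real.exp_le_exp.2 ?_ : _ ≤ Real.exp (ν ^ 2 * (l * R) ^ 2 / 2)))).trans ?_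
      · have h3 : (l' * c i) ^ 2 ≤ (l * R) ^ 2 := by
          rw [← sq_abs (l' * c i), abs_mul, hl', abs_of_nonneg (hc i).1]
          exact pow_le_pow_left₀ (mul_nonneg hlpos.le (hc i).1)
            (mul_le_mul_of_nonneg_left (hc i).2 hlpos.le) 2
        have := mul_le_mul_of_nonneg_left h3 hν.le
        linarith
      · simp
    refine (mul_le_mul_of_nonneg_left h1 (Real.exp_nonneg _)).trans (le_of_eq ?_)
    rw [← Real.exp_add]
    congr 1
    rw [hl]
    have hν0 : ν ≠ 0 := fun h => by simp [h] at hν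
    field_simp
    ring
  have hint : ∀ l' : ℝ, |l'| = l → Integrable (fun ω => Real.exp (l' * (∑ i, X i) ω)) P :=
    fun l' hl' => hXi.integrable_exp_mul_sum hXm fun i _ =>
      (hξ.mgf_le hD (T i) (c i) l' (hcond l' hl' i)).1
  have hup := (measure_ge_le_exp_mul_mgf (m * η) hlpos.le (hint l (abs_of_pos hlpos))).trans
    (hmgf l (abs_of_pos hlpos))
  have hneg : |-l| = l := by rw [abs_neg, abs_of_pos hlpos]
  have hlow := (measure_le_le_exp_mul_mgf (-(m * η)) (neg_nonpos.2 hlpos.le) (hint (-l) hneg))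
  rw [show - -l * -(m * η) = -l * (m * η) by ring] at hlow
  have hlow := hlow.trans (hmgf (-l) hneg)
  have hsub : {ω | m * η ≤ |∑ i, c i * (ξ (T i) ω - 1)|} ⊆
      {ω | m * η ≤ (∑ i, X i) ω} ∪ {ω | (∑ i, X i) ω ≤ -(m * η)} := by
    intro ω hω
    simp only [Set.mem_ofPred_eq, Set.mem_union, Finset.sum_apply, hX] at hω ⊢
    rcases le_abs.1 hω with h | h
    · exact Or.inl h
    · exact Or.inr (by linarith)
  calc _ ≤ P.real ({ω | m * η ≤ (∑ i, X i) ω} ∪ {ω | (∑ i, X i) ω ≤ -(m * η)}) :=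
        measureReal_mono hsub
    _ ≤ _ := measureReal_union_le _ _
    _ ≤ _ := by linarith

/-! ### The smoothed objective -/

/-- The average value of `f` on `S` together with a uniform `t`-subset of `H`. -/
noncomputable def smoothed {N : Type u} [DecidableEq N] (f : Finset N → ℝ) (H : Finset N) (t : ℕ) :
    Finset N → ℝ :=
  fun S => 𝔼 T ∈ H.powersetCard t, f (S ∪ T)

theorem NonnegSubmodularOn.smoothed {N : Type u} [DecidableEq N] {f : Finset N → ℝ}
    (hf : NonnegSubmodularOn Set.univ f) (H : Finset N) (t : ℕ) {E : Set N}
    (hE : ∀ x ∈ E, x ∉ H) : NonnegSubmodularOn E (smoothed f H t) where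
  nonneg S _ := Finset.expect_nonneg fun T _ => hf.nonneg _ (Set.subset_univ _)
  submod A B hAB hB x hx hxB := by
    simp only [NoisySubmodular.smoothed, ← Finset.expect_sub_distrib, Finset.insert_union]
    refine Finset.expect_le_expect fun T hT => ?_
    refine hf.submod _ _ (Finset.union_subset_union_left hAB) (Set.subset_univ _) x trivial ?_
    rw [Finset.mem_union, not_or]
    exact ⟨hxB, fun h => hE x hx ((Finset.mem_powersetCard.1 hT).1 h)⟩

theorem NonnegMonotoneSubmodularOn.smoothed {N : Type u} [DecidableEq N] {f : Finset N → ℝ}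
    (hf : NonnegMonotoneSubmodularOn Set.univ f) (H : Finset N) (t : ℕ) {E : Set N}
    (hE : ∀ x ∈ E, x ∉ H) : NonnegMonotoneSubmodularOn E (smoothed f H t) where
  toNonnegSubmodularOn := hf.toNonnegSubmodularOn.smoothed H t hE
  mono _ _ hAB _ := Finset.expect_le_expect fun _ _ =>
    hf.mono _ _ (Finset.union_subset_union_left hAB) (Set.subset_univ _)

theorem nonnegMonotoneSubmodularOn_zero {N : Type u} [DecidableEq N] (E : Set N) :
    NonnegMonotoneSubmodularOn E fun _ : Finset N => (0 : ℝ) where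
  nonneg := by simp
  submod := by simp
  mono := by simp

theorem exists_isOptimal {N : Type u} [Fintype N] (M : Matroid N) (f : Finset N → ℝ) :
    ∃ O : Finset N, IsOptimal M f O := by
  classical
  obtain ⟨O, hO, hmax⟩ := Finset.exists_max_image {S : Finset N | M.Indep (S : Set N)} f
    ⟨∅, by simp⟩
  simp only [Finset.mem_filter, Finset.mem_univ, true_and] at hO hmax
  exact ⟨O, hO, hmax⟩

/-! ### The averaged noisy oracle is an approximate oracle -/

/-- The term `n` in the exponent pays for the union bound, as `2 ^ n ≤ exp n`; the logarithm leaves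
`2 / (4n)`. -/
theorem two_pow_mul_exp_le {n : ℕ} (hn : 0 < n) {q : ℝ}
    (hq : n + Real.log (4 / (1 / (n : ℝ))) ≤ q) :
    (2 : ℝ) ^ n * (2 * Real.exp (-q)) ≤ 1 / (2 * n) := by
  have hn' : (0 : ℝ) < n := by exact_mod_cast hn
  have h1 : Real.exp (-q) ≤ Real.exp (-n) / (4 * n) := by
    have h2 : Real.exp (-q) ≤ Real.exp (-n - Real.log (4 / (1 / (n : ℝ)))) :=
      Real.exp_le_exp.2 (by linarith)
    rwa [Real.exp_sub, Real.exp_log (by positivity), one_div, div_inv_eq_mul] at h2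
  have h3 : (2 : ℝ) ^ n * Real.exp (-n) ≤ 1 := by
    have h4 : (2 : ℝ) ≤ Real.exp 1 := by
      have := Real.add_one_le_exp (1 : ℝ)
      linarith
    have h5 : (2 : ℝ) ^ n ≤ Real.exp n := by
      have := pow_le_pow_left₀ (by norm_num) h4 n
      rwa [← Real.exp_nat_mul, mul_one] at this
    calc (2 : ℝ) ^ n * Real.exp (-n) ≤ Real.exp n * Real.exp (-n) :=
          mul_le_mul_of_nonneg_right h5 (Real.exp_nonneg _)
      _ = 1 := by rw [← Real.exp_add]; simp
  calc (2 : ℝ) ^ n * (2 * Real.exp (-q)) ≤ 2 ^ n * (2 * (Real.exp (-n) / (4 * n))) := by gcongr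
    _ = (2 ^ n * Real.exp (-n)) * (1 / (2 * n)) := by field_simp; ring
    _ ≤ 1 * (1 / (2 * n)) := mul_le_mul_of_nonneg_right h3 (by positivity)
    _ = _ := one_mul _

/-- The sampled sets represent the smoothed objective up to an error less than `η`. -/
def IsRepresentative {N : Type u} [DecidableEq N] (f : Finset N → ℝ) (H : Finset N) (t : ℕ) (η : ℝ)
    {m : ℕ} (Hs : Fin m → Finset N) : Prop :=
  ∀ S : Finset N, Disjoint S H → |∑ i, f (S ∪ Hs i) - m * smoothed f H t S| < m * η

open Classical in
theorem card_not_isRepresentative_le {N : Type u} [Fintype N] [DecidableEq N] {f : Finset N → ℝ}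
    {R η : ℝ} (hf : ∀ S, f S ∈ Set.Icc 0 R) (hR : 0 < R) (hη : 0 < η) (H : Finset N) (t m : ℕ)
    (hm : m ≤ H.card.choose t) :
    (({Hs ∈ samples H t m | ¬ IsRepresentative f H t η Hs}).card : ℝ) ≤
      (samples H t m).card *
        (2 ^ Fintype.card N * (2 * Real.exp (-(2 * m * η ^ 2 / R ^ 2)))) := by
  have hsub : {Hs ∈ samples H t m | ¬ IsRepresentative f H t η Hs} ⊆
      (Finset.univ : Finset (Finset N)).biUnion fun S => {Hs ∈ samples H t m | m * η ≤
        |∑ i, f (S ∪ Hs i) - m * ((∑ T ∈ H.powersetCard t, f (S ∪ T)) /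
          (H.powersetCard t).card)|} := by
    intro Hs hHs
    simp only [IsRepresentative, Finset.mem_filter, not_forall, not_lt] at hHs
    obtain ⟨h1, S, _, h2⟩ := hHs
    rw [smoothed, Finset.expect_eq_sum_div_card] at h2
    exact Finset.mem_biUnion.2 ⟨S, Finset.mem_univ _, Finset.mem_filter.2 ⟨h1, h2⟩⟩
  have h1 := (Finset.card_le_card hsub).trans Finset.card_biUnion_le
  have h2 : (({Hs ∈ samples H t m | ¬ IsRepresentative f H t η Hs}).card : ℝ) ≤
      ∑ S : Finset N, (({Hs ∈ samples H t m | m * η ≤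
        |∑ i, f (S ∪ Hs i) - m * ((∑ T ∈ H.powersetCard t, f (S ∪ T)) /
          (H.powersetCard t).card)|}).card : ℝ) := by exact_mod_cast h1
  refine h2.trans ((Finset.sum_le_sum (g := fun _ =>
    ((samples H t m).card : ℝ) * (2 * Real.exp (-(2 * m * η ^ 2 / R ^ 2)))) fun S _ => ?_).trans
    (le_of_eq ?_))
  · exact card_injTuples_abs_ge_le (fun T => f (S ∪ T)) hR hη m (H.powersetCard t)
      (by rwa [Finset.card_powersetCard]) fun T _ => hf _
  · rw [Finset.sum_const, Finset.card_univ, Fintype.card_finset, nsmul_eq_mul]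
    push_cast
    ring

/-- The outcomes for which the noise changes some sample average by at least `η`. -/
def badNoise {N : Type u} [Fintype N] [DecidableEq N] {Ω : Type w} (ξ : Finset N → Ω → ℝ)
    (f : Finset N → ℝ) (H : Finset N) (η : ℝ) {m : ℕ} (Hs : Fin m → Finset N) : Set Ω :=
  ⋃ S ∈ ({S | Disjoint S H} : Finset (Finset N)),
    {ω | m * η ≤ |∑ i, f (S ∪ Hs i) * (ξ (S ∪ Hs i) ω - 1)|}

theorem IsNoise.measurableSet_badNoise {N : Type u} [Fintype N] [DecidableEq N] {Ω : Type w}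
    [MeasurableSpace Ω] {P : Measure Ω} {ξ : Finset N → Ω → ℝ} {D : Measure ℝ}
    (hξ : IsNoise P ξ D) (f : Finset N → ℝ) (H : Finset N) (η : ℝ) {m : ℕ}
    (Hs : Fin m → Finset N) : MeasurableSet (badNoise ξ f H η Hs) := by
  refine Finset.measurableSet_biUnion _ fun S _ => measurableSet_le measurable_const ?_
  refine (Finset.measurable_fun_sum _ fun i _ => ?_).abs
  exact ((hξ.measurable _).sub_const 1).const_mul _

theorem union_left_injective_of_disjoint {N : Type u} [DecidableEq N] {S H : Finset N}
    (hS : Disjoint S H) {A B : Finset N} (hA : A ⊆ H) (hB : B ⊆ H) (h : S ∪ A = S ∪ B) : A = B := by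
  have hAS := hS.mono_right hA
  have hBS := hS.mono_right hB
  rw [← Finset.union_sdiff_cancel_left hAS, h, Finset.union_sdiff_cancel_left hBS]

/-- For `S` disjoint from `H`, distinct `Hs i` give distinct sets `S ∪ Hs i`, hence independent
multipliers. Different `S` are combined by a union bound only. -/
theorem IsNoise.measureReal_badNoise_le {N : Type u} [Fintype N] [DecidableEq N] {Ω : Type w}
    [MeasurableSpace Ω] {P : Measure Ω} [IsProbabilityMeasure P] {ξ : Finset N → Ω → ℝ}
    {D : Measure ℝ} (hξ : IsNoise P ξ D) {ν a : ℝ} (ha : 0 ≤ a) (hD : IsSubExponential D ν a)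
    {f : Finset N → ℝ} {R η : ℝ} (hf : ∀ S, f S ∈ Set.Icc 0 R) (hR : 0 < R) (hν : 0 < ν ^ 2)
    (hη : 0 < η) (hηa : η * a ≤ ν ^ 2 * R) {H : Finset N} {t m : ℕ} {Hs : Fin m → Finset N}
    (hHs : Hs ∈ samples H t m) :
    P.real (badNoise ξ f H η Hs) ≤
      2 ^ Fintype.card N * (2 * Real.exp (-(m * η ^ 2 / (2 * ν ^ 2 * R ^ 2)))) := by
  rw [samples_eq_injTuples, mem_injTuples] at hHs
  refine (measureReal_biUnion_finset_le _ _).trans ((Finset.sum_le_sum (g := fun _ =>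
    2 * Real.exp (-(m * η ^ 2 / (2 * ν ^ 2 * R ^ 2)))) fun S hS => ?_).trans ?_)
  · simp only [Finset.mem_filter, Finset.mem_univ, true_and] at hS
    refine hξ.measureReal_abs_sum_ge_le ha hD (T := fun i => S ∪ Hs i) (fun i j hij => hHs.2 ?_)
      (fun i => f (S ∪ Hs i)) hR hν hη hηa fun i => hf _
    exact union_left_injective_of_disjoint hS (Finset.mem_powersetCard.1 (hHs.1 i)).1
      (Finset.mem_powersetCard.1 (hHs.1 j)).1 hij
  · rw [Finset.sum_const, nsmul_eq_mul]
    refine mul_le_mul_of_nonneg_right ?_ (by positivity)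
    have := Finset.card_le_univ ({S | Disjoint S H} : Finset (Finset N))
    rw [Fintype.card_finset] at this
    exact_mod_cast this

theorem isApproxOracle_sampleAverage {N : Type u} [Fintype N] [DecidableEq N] {Ω : Type w}
    {ξ : Finset N → Ω → ℝ} {f : Finset N → ℝ} {H : Finset N} {t m : ℕ} {ε : ℝ} (hm : 0 < m)
    {Hs : Fin m → Finset N} (hHs : IsRepresentative f H t (ε / 2) Hs) {ω : Ω}
    (hω : ω ∉ badNoise ξ f H (ε / 2) Hs) {E : Set N} (hE : ∀ x ∈ E, x ∉ H) :
    IsApproxOracle E ε (smoothed f H t) (sampleAverage (noisyOracle ξ f ω) Hs) := by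
  intro S hS
  have hd : Disjoint S H := Finset.disjoint_left.2 fun x hx => hE x (hS hx)
  have h1 := hHs S hd
  have h2 : |∑ i, f (S ∪ Hs i) * (ξ (S ∪ Hs i) ω - 1)| < m * (ε / 2) := by
    by_contra hcon
    rw [not_lt] at hcon
    exact hω (Set.mem_biUnion (by simpa using hd) hcon)
  have hm' : (0 : ℝ) < m := by exact_mod_cast hm
  have h3 : sampleAverage (noisyOracle ξ f ω) Hs S - smoothed f H t S =
      (∑ i, f (S ∪ Hs i) * (ξ (S ∪ Hs i) ω - 1) +
        (∑ i, f (S ∪ Hs i) - m * smoothed f H t S)) / m := by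
    have h4 : ∑ i, noisyOracle ξ f ω (S ∪ Hs i) =
        ∑ i, f (S ∪ Hs i) * (ξ (S ∪ Hs i) ω - 1) + ∑ i, f (S ∪ Hs i) := by
      rw [← Finset.sum_add_distrib]
      refine Finset.sum_congr rfl fun i _ => ?_
      rw [noisyOracle]
      ring
    rw [sampleAverage, h4]
    field_simp
    ring
  rw [h3, abs_div, abs_of_pos hm', div_le_iff₀ hm']
  refine (abs_add_le _ _).trans ?_
  linarith

/-! ### The expected value of the meta-algorithm -/

theorem Algorithm.integrable_comp_run {N : Type u} [Fintype N] (A : Algorithm.{u, v} N)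
    (M : Matroid N) {Ω : Type w} [MeasurableSpace Ω] (P : Measure Ω) [IsProbabilityMeasure P]
    {g : Ω → Finset N → ℝ} (hg : Measurable g) (k : Finset N → ℝ) :
    Integrable (fun p : Ω × A.Seed => k ((A.prog M p.2).run (g p.1))) (P.prod A.μ) := by
  let : MeasurableSpace (Finset N) := ⊤
  have hmeas : Measurable fun p : Ω × A.Seed => (A.prog M p.2).run (g p.1) := by
    refine measurable_to_countable' fun T => ?_
    have hpair : Measurable fun p : Ω × A.Seed => (p.2, g p.1) :=
      measurable_snd.prodMk (hg.comp measurable_fst)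
    exact hpair (A.measurable_run M T)
  have hk : Measurable k := fun _ _ => trivial
  refine Integrable.of_bound (hk.comp hmeas).aestronglyMeasurable (∑ T : Finset N, |k T|)
    (Filter.Eventually.of_forall fun p => ?_)
  exact Finset.single_le_sum (f := fun T => |k T|) (fun T _ => abs_nonneg _) (Finset.mem_univ _)

/-- The set found by `A` does not depend on `H'`, so averaging over `H'` inside the integral turns
`f` into the smoothed objective. -/
theorem expect_integral_metaProg {N : Type u} [Fintype N] [DecidableEq N] (A : Algorithm.{u, v} N)
    (M : Matroid N) {Ω : Type w} [MeasurableSpace Ω] (P : Measure Ω) [IsProbabilityMeasure P]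
    {ξ : Finset N → Ω → ℝ} (hξ : ∀ S, Measurable (ξ S)) (f : Finset N → ℝ) (H : Finset N)
    (t : ℕ) {m : ℕ} (Hs : Fin m → Finset N) :
    Integrable (fun ω => A.expectedValue (M ／ (H : Set N))
      (sampleAverage (noisyOracle ξ f ω) Hs) (smoothed f H t)) P ∧
    𝔼 H' ∈ H.powersetCard t,
      ∫ p : Ω × A.Seed, f ((metaProg A M H Hs H' p.2).run (noisyOracle ξ f p.1)) ∂(P.prod A.μ) =
      ∫ ω, A.expectedValue (M ／ (H : Set N)) (sampleAverage (noisyOracle ξ f ω) Hs)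
        (smoothed f H t) ∂P := by
  have hg : Measurable fun ω => sampleAverage (noisyOracle ξ f ω) Hs := by
    refine measurable_pi_lambda _ fun S => Measurable.div_const ?_ _
    exact Finset.measurable_fun_sum _ fun i _ => (hξ _).mul_const _
  have hint := A.integrable_comp_run (M ／ (H : Set N)) P hg
  refine ⟨(hint (smoothed f H t)).integral_prod_left, ?_⟩
  have h1 := integral_prod _ (hint (smoothed f H t))
  unfold Algorithm.expectedValue
  rw [← h1]
  simp only [metaProg, QueryProg.run_smooth, smoothed, Finset.expect_eq_sum_div_card]
  rw [integral_div, integral_finsetSum _ fun T _ => hint fun S => f (S ∪ T)]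

theorem sub_mul_le_integral {Ω : Type w} [MeasurableSpace Ω] {P : Measure Ω}
    [IsProbabilityMeasure P] {X : Ω → ℝ} (hX : Integrable X P) (h0 : ∀ ω, 0 ≤ X ω) {U : Set Ω}
    (hU : MeasurableSet U) {δ V : ℝ} (hUδ : P.real U ≤ δ) (hV : 0 ≤ V)
    (hVX : ∀ ω, ω ∉ U → V ≤ X ω) : (1 - δ) * V ≤ ∫ ω, X ω ∂P := by
  have h1 : ∫ ω, Uᶜ.indicator (fun _ => V) ω ∂P ≤ ∫ ω, X ω ∂P := by
    refine integral_mono ((integrable_const V).indicator hU.compl) hX fun ω => ?_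
    by_cases hω : ω ∈ U
    · simpa [hω] using h0 ω
    · simpa [hω] using hVX ω hω
  rw [integral_indicator_const _ hU.compl, probReal_compl_eq_one_sub hU, smul_eq_mul] at h1
  refine le_trans (mul_le_mul_of_nonneg_right ?_ hV) h1
  linarith

/-- For a fixed `H`, the meta-algorithm keeps a fraction `1 - 1/n` of any value that `A` guarantees
with every approximate oracle of the smoothed objective. -/
theorem le_expect_samples {N : Type u} [Fintype N] [DecidableEq N] {Ω : Type w}
    [MeasurableSpace Ω] {P : Measure Ω} [IsProbabilityMeasure P] {ξ : Finset N → Ω → ℝ}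
    {D : Measure ℝ} (hξ : IsNoise P ξ D) {ν a : ℝ} (ha : 0 ≤ a) (hD : IsSubExponential D ν a)
    {f : Finset N → ℝ} {R ε : ℝ} (hf : ∀ S, f S ∈ Set.Icc 0 R) (hε : 0 < ε)
    (hεa : ε * a < 2 * ν ^ 2 * R) {h t m : ℕ} (hn : 0 < Fintype.card N)
    (hpar : ParamCondition (Fintype.card N) ν R ε (1 / Fintype.card N) h t m)
    (A : Algorithm.{u, v} N) (M : Matroid N) {H : Finset N} (hH : H.card = h) {V : ℝ} (hV : 0 ≤ V)
    (hrob : ∀ g, IsApproxOracle (M ／ (H : Set N)).E ε (smoothed f H t) g →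
      V ≤ A.expectedValue (M ／ (H : Set N)) g (smoothed f H t)) :
    (1 - 1 / (Fintype.card N : ℝ)) * V ≤
      𝔼 Hs ∈ samples H t m, 𝔼 H' ∈ H.powersetCard t,
        ∫ p : Ω × A.Seed, f ((metaProg A M H Hs H' p.2).run (noisyOracle ξ f p.1))
          ∂(P.prod A.μ) := by
  classical
  -- The strict inequality also forces `R > 0` and `ν ≠ 0`, since its left side is non-negative.
  have hpos : 0 < 2 * ν ^ 2 * R := lt_of_le_of_lt (by positivity) hεa
  have hR : 0 < R := pos_of_mul_pos_right hpos (by positivity)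
  have hν : 0 < ν ^ 2 := by
    rcases (sq_nonneg ν).eq_or_lt with h0 | h0
    · rw [← h0] at hpos; simp at hpos
    · exact h0
  have hm : 0 < m := hpar.pos hn hR hε
  have hm' : (0 : ℝ) < m := by exact_mod_cast hm
  have hmc : m ≤ H.card.choose t := hH ▸ hpar.le_choose hm
  set n := Fintype.card N with hndef
  have hn1 : (1 : ℝ) ≤ n := by exact_mod_cast hn
  set L : ℝ := n + Real.log (4 / (1 / (n : ℝ))) with hL
  have hL0 : 0 ≤ L := by
    have : 0 ≤ Real.log (4 / (1 / (n : ℝ))) := by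
      refine Real.log_nonneg ?_
      rw [one_div, div_inv_eq_mul]
      linarith
    positivity
  -- At error `ε / 2`, the constant `2` is what the sampling exponent needs, and `8 * ν ^ 2` what
  -- the noise exponent needs.
  have hmL : ∀ κ : ℝ, κ ≤ max 2 (8 * ν ^ 2) → κ * (R ^ 2 / ε ^ 2) * L ≤ m := fun κ hκ =>
    (by gcongr : κ * (R ^ 2 / ε ^ 2) * L ≤ max 2 (8 * ν ^ 2) * (R ^ 2 / ε ^ 2) * L).trans hpar.1
  have hq1 : L ≤ 2 * m * (ε / 2) ^ 2 / R ^ 2 := by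
    have h1 := hmL 2 (le_max_left _ _)
    rw [le_div_iff₀ (by positivity)]
    have h2 := mul_le_mul_of_nonneg_right h1 (sq_nonneg ε)
    have h3 : 2 * (R ^ 2 / ε ^ 2) * L * ε ^ 2 = 2 * (L * R ^ 2) := by field_simp
    rw [h3] at h2
    linarith
  have hq2 : L ≤ m * (ε / 2) ^ 2 / (2 * ν ^ 2 * R ^ 2) := by
    have h1 := hmL (8 * ν ^ 2) (le_max_right _ _)
    rw [le_div_iff₀ (by positivity)]
    have h2 := mul_le_mul_of_nonneg_right h1 (sq_nonneg ε)
    have h3 : 8 * ν ^ 2 * (R ^ 2 / ε ^ 2) * L * ε ^ 2 = 4 * (L * (2 * ν ^ 2 * R ^ 2)) := by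
      field_simp; ring
    rw [h3] at h2
    linarith
  set δ : ℝ := 1 / (2 * n) with hδ
  have hδ1 : δ ≤ 1 := by
    rw [hδ]
    exact div_le_one_of_le₀ (by linarith) (by positivity)
  have hE : ∀ x ∈ (M ／ (H : Set N)).E, x ∉ H := fun x hx hxH => by
    rw [Matroid.contract_ground] at hx
    exact hx.2 hxH
  have hval0 : ∀ g, 0 ≤ A.expectedValue (M ／ (H : Set N)) g (smoothed f H t) := fun g =>
    integral_nonneg fun s => Finset.expect_nonneg fun T _ => (hf _).1
  have hpt : ∀ Hs ∈ samples H t m,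
      (if IsRepresentative f H t (ε / 2) Hs then (1 - δ) * V else 0) ≤
      𝔼 H' ∈ H.powersetCard t, ∫ p : Ω × A.Seed,
        f ((metaProg A M H Hs H' p.2).run (noisyOracle ξ f p.1)) ∂(P.prod A.μ) := by
    intro Hs hHs
    obtain ⟨hi, he⟩ := expect_integral_metaProg A M P hξ.measurable f H t Hs
    rw [he]
    split_ifs with hrep
    · refine sub_mul_le_integral hi (fun ω => hval0 _)
        (hξ.measurableSet_badNoise f H (ε / 2) Hs) ?_ hV fun ω hω =>
          hrob _ (isApproxOracle_sampleAverage hm hrep hω hE)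
      refine (hξ.measureReal_badNoise_le ha hD hf hR hν (half_pos hε) (by linarith) hHs).trans ?_
      exact two_pow_mul_exp_le hn hq2
    · exact integral_nonneg fun ω => hval0 _
  refine le_trans ?_ (Finset.expect_le_expect hpt)
  have hne : (samples H t m).Nonempty :=
    injTuples_nonempty (by rwa [Finset.card_powersetCard])
  have hcpos : (0 : ℝ) < (samples H t m).card := by exact_mod_cast hne.card_pos
  rw [Finset.expect_eq_sum_div_card, le_div_iff₀ hcpos, ← Finset.sum_filter, Finset.sum_const,
    nsmul_eq_mul]
  have hbad := (card_not_isRepresentative_le hf hR (half_pos hε) H t m hmc).trans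
    (mul_le_mul_of_nonneg_left (two_pow_mul_exp_le hn hq1) hcpos.le)
  have hsplit : (({Hs ∈ samples H t m | IsRepresentative f H t (ε / 2) Hs}).card : ℝ) +
      ({Hs ∈ samples H t m | ¬ IsRepresentative f H t (ε / 2) Hs}).card =
        (samples H t m).card := by
    exact_mod_cast Finset.card_filter_add_card_filter_not
      (s := samples H t m) (fun Hs => IsRepresentative f H t (ε / 2) Hs)
  have hgood : (samples H t m).card * (1 - δ) ≤
      (({Hs ∈ samples H t m | IsRepresentative f H t (ε / 2) Hs}).card : ℝ) := by
    linarith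
  have h1δ : 0 ≤ (1 - δ) * V := mul_nonneg (by linarith) hV
  refine le_trans ?_ (mul_le_mul_of_nonneg_right hgood h1δ)
  -- One factor is for representative samples, the other for good noise given the sample.
  have hfin : (1 - 1 / (n : ℝ)) ≤ (1 - δ) * (1 - δ) := by
    have : (1 : ℝ) / n = 2 * δ := by rw [hδ]; field_simp
    rw [this]
    nlinarith [sq_nonneg δ]
  calc (1 - 1 / (n : ℝ)) * V * (samples H t m).card
      ≤ (1 - δ) * (1 - δ) * V * (samples H t m).card := by gcongr
    _ = _ := by ring

/-- The guarantee of the meta-algorithm for a class of functions that contains the smoothed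
objectives, when smoothing keeps a fraction `γ` of the value. -/
theorem le_metaExpectedValue {N : Type u} [Fintype N] [DecidableEq N] {Ω : Type w}
    [MeasurableSpace Ω] {P : Measure Ω} [IsProbabilityMeasure P] {ξ : Finset N → Ω → ℝ}
    {D : Measure ℝ} (hξ : IsNoise P ξ D) {ν a : ℝ} (ha : 0 ≤ a) (hD : IsSubExponential D ν a)
    {f : Finset N → ℝ} (hf : NonnegSubmodularOn Set.univ f) {R ε : ℝ} (hfR : ∀ S, f S ≤ R)
    (hε : 0 < ε) (hεa : ε * a < 2 * ν ^ 2 * R) {h t m : ℕ} (hn : 0 < Fintype.card N)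
    (hpar : ParamCondition (Fintype.card N) ν R ε (1 / Fintype.card N) h t m)
    (A : Algorithm.{u, v} N) {M : Matroid N} {O : Finset N} (hO : M.Indep (O : Set N))
    {B₀ : Finset N} (hB₀ : M.IsBase (B₀ : Set N)) (hhr : h < B₀.card) {𝓜 : Set (Matroid N)}
    (h𝓜 : ∀ H ∈ B₀.powersetCard h, M ／ (H : Set N) ∈ 𝓜) {𝓕 : Set N → (Finset N → ℝ) → Prop}
    (h𝓕0 : ∀ E, 𝓕 E fun _ => 0)
    (h𝓕 : ∀ (H : Finset N) (E : Set N), (∀ x ∈ E, x ∉ H) → 𝓕 E (smoothed f H t))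
    {α b γ : ℝ} (hα : 0 ≤ α) (hγ0 : 0 ≤ γ)
    (hγ : ∀ H S : Finset N, H.card = h → Disjoint S H → γ * f S ≤ smoothed f H t S)
    (hrob : A.IsRobust 𝓜 𝓕 α ε b) :
    α * ((1 - 1 / (Fintype.card N : ℝ)) * γ * (1 - (h : ℝ) / B₀.card)) * f O - b ≤
      metaExpectedValue A M B₀ h t m P ξ f := by
  have hfI : ∀ S, f S ∈ Set.Icc 0 R := fun S => ⟨hf.nonneg S (Set.subset_univ _), hfR S⟩
  have hne : (B₀.powersetCard h).Nonempty := Finset.powersetCard_nonempty.2 hhr.le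
  -- Robustness applied to the zero objective with the zero oracle forces `b ≥ 0`, so that scaling
  -- `b` by `q ≤ 1` is harmless below.
  have hb : 0 ≤ b := by
    obtain ⟨H, hH⟩ := hne
    obtain ⟨O', hO'⟩ := exists_isOptimal (M ／ (H : Set N)) fun _ => 0
    have := hrob _ (h𝓜 H hH) _ (h𝓕0 _) (fun _ => 0) (fun S _ => by simpa using hε.le) O' hO'
    simp only [Algorithm.expectedValue, integral_zero] at this
    linarith
  have hn1 : (1 : ℝ) ≤ Fintype.card N := by exact_mod_cast hn
  set q : ℝ := 1 - 1 / (Fintype.card N : ℝ) with hq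
  have hq0 : 0 ≤ q := by
    rw [hq, sub_nonneg]
    exact div_le_one_of_le₀ hn1 (by positivity)
  have hq1 : q ≤ 1 := by
    rw [hq, sub_le_self_iff]
    positivity
  have hfix : ∀ H ∈ B₀.powersetCard h, α * q * γ * contractValue M f H - b ≤
      𝔼 Hs ∈ samples H t m, 𝔼 H' ∈ H.powersetCard t,
        ∫ p : Ω × A.Seed, f ((metaProg A M H Hs H' p.2).run (noisyOracle ξ f p.1))
          ∂(P.prod A.μ) := by
    intro H hH
    obtain ⟨hHB, hHc⟩ := Finset.mem_powersetCard.1 hH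
    have hHi : M.Indep (H : Set N) := hB₀.indep.subset (by exact_mod_cast hHB)
    have hE : ∀ x ∈ (M ／ (H : Set N)).E, x ∉ H := fun x hx hxH => by
      rw [Matroid.contract_ground] at hx
      exact hx.2 hxH
    obtain ⟨O', hO'⟩ := exists_isOptimal (M ／ (H : Set N)) (smoothed f H t)
    obtain ⟨S, hS, hSv⟩ := exists_eq_contractValue M f H
    have hSH : Disjoint S H := by
      rw [hHi.contract_indep_iff] at hS
      exact_mod_cast hS.1
    have hval : γ * contractValue M f H ≤ smoothed f H t O' := by
      rw [← hSv]
      exact (hγ H S hHc hSH).trans (hO'.2 S hS)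
    have hcv : 0 ≤ contractValue M f H := hSv ▸ (hfI S).1
    have hαv : 0 ≤ α * (γ * contractValue M f H) := by positivity
    have hαval := mul_le_mul_of_nonneg_left hval hα
    have hα1 : q * (α * (γ * contractValue M f H)) ≤ α * (γ * contractValue M f H) :=
      mul_le_of_le_one_left hαv hq1
    rcases le_or_gt 0 (α * (γ * contractValue M f H) - b) with hV | hV
    · have h1 := le_expect_samples hξ ha hD hfI hε hεa hn hpar A M hHc hV fun g hg =>
        le_trans (sub_le_sub_right hαval b) (hrob _ (h𝓜 H hH) _ (h𝓕 H _ hE) g hg O' hO')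
      refine le_trans ?_ h1
      rw [← hq, mul_sub]
      have : q * b ≤ b := mul_le_of_le_one_left hb hq1
      linarith
    -- Here the guarantee is negative, and non-negativity of `f` suffices.
    · have h0 : 0 ≤ 𝔼 Hs ∈ samples H t m, 𝔼 H' ∈ H.powersetCard t,
          ∫ p : Ω × A.Seed, f ((metaProg A M H Hs H' p.2).run (noisyOracle ξ f p.1))
            ∂(P.prod A.μ) :=
        Finset.expect_nonneg fun _ _ => Finset.expect_nonneg fun _ _ =>
          integral_nonneg fun _ => (hfI _).1
      linarith
  refine le_trans ?_ (Finset.expect_le_expect hfix)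
  rw [Finset.expect_sub_distrib, Finset.expect_const hne, ← Finset.mul_expect]
  have := mul_le_mul_of_nonneg_left (le_expect_contractValue hf hB₀ hO h hhr)
    (by positivity : 0 ≤ α * q * γ)
  linarith

theorem one_sub_le_mul_one_sub {x y z x' y' : ℝ} (hx : 0 ≤ x) (hy : 0 ≤ y) (hz : 0 ≤ z)
    (hx1 : x ≤ 1) (hxx' : x ≤ x') (hyy' : y ≤ y') :
    1 - x' - y' - z ≤ (1 - z) * (1 - y) * (1 - x) := by
  have h1 : (1 - y) * (1 - x) ≤ 1 :=
    mul_le_one₀ (by linarith) (by linarith) (by linarith)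
  nlinarith [mul_nonneg hx hy, mul_le_mul_of_nonneg_left h1 hz]

theorem div_le_div_sub_self {x y : ℝ} (hx : 0 ≤ x) (hxy : x < y) : x / y ≤ x / (y - x) :=
  div_le_div_of_nonneg_left hx (by linarith) (by linarith)

end NoisySubmodular

open NoisySubmodular in
/-- `a` is the second sub-exponential parameter and `ε < (2 ν² / a) fmax` is written
`ε * a < 2 ν² fmax`. The class `𝓜` of constraints that `A` handles (for example all matroids, or
all uniform ones) only has to contain the contractions on which `A` is run. -/
theorem theorem3p2 {N : Type*} [Fintype N] [DecidableEq N]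
    -- the objective and the constraint
    (f : Finset N → ℝ) (hf : NonnegSubmodularOn Set.univ f)
    (fmax : ℝ) (hfmax : ∀ S, f S ≤ fmax)
    (M : Matroid N) (hM : M.E = Set.univ) (r : ℕ) (hr : M.eRank = r)
    (O : Finset N) (hO : IsOptimal M f O)
    -- the noise
    {Ω : Type*} [MeasurableSpace Ω] (P : Measure Ω) [IsProbabilityMeasure P]
    (ξ : Finset N → Ω → ℝ) (D : Measure ℝ) (hξ : IsNoise P ξ D)
    (ν a : ℝ) (ha : 0 ≤ a) (hD : IsSubExponential D ν a)
    -- the parameters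
    (ε : ℝ) (hε : 0 < ε) (hε' : ε * a < 2 * ν ^ 2 * fmax)
    (h t m : ℕ) (hpar : ParamCondition (Fintype.card N) ν fmax ε (1 / Fintype.card N) h t m)
    (hhr : h < r)
    -- the basis used by the meta-algorithm, and the algorithm `A`
    (B₀ : Finset N) (hB₀ : M.IsBase (B₀ : Set N))
    (A : Algorithm N) (𝓜 : Set (Matroid N))
    (h𝓜 : ∀ H ∈ B₀.powersetCard h, M ／ (H : Set N) ∈ 𝓜)
    (α : ℝ) (hα : 0 ≤ α) (β : ℝ → ℝ) :
    -- general submodular functions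
    (A.HasApproxRatio 𝓜 NonnegSubmodularOn α → A.IsRobust 𝓜 NonnegSubmodularOn α ε (β ε) →
      α * (1 - (h : ℝ) / ((r : ℝ) - h) - (t : ℝ) / ((h : ℝ) - t) - 1 / Fintype.card N) * f O - β ε
        ≤ metaExpectedValue A M B₀ h t m P ξ f) ∧
    -- monotone submodular functions
    (NonnegMonotoneSubmodularOn Set.univ f →
      A.HasApproxRatio 𝓜 NonnegMonotoneSubmodularOn α → A.IsRobust 𝓜 NonnegMonotoneSubmodularOn α ε (β ε) →
      α * (1 - (h : ℝ) / ((r : ℝ) - h) - 1 / Fintype.card N) * f O - β ε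
        ≤ metaExpectedValue A M B₀ h t m P ξ f) ∧
    -- `H₁, …, Hₘ` can be sampled, and the returned set is always feasible
    (∀ H ∈ B₀.powersetCard h, (samples H t m).Nonempty ∧
      ∀ Hs ∈ samples H t m, ∀ H' ∈ H.powersetCard t, ∀ (s : A.Seed) (g : Finset N → ℝ),
        M.Indep ((metaProg A M H Hs H' s).run g : Set N)) ∧
    -- the number of queries: `m` times that of `A`, in every run and in the worst case
    (∀ H ∈ B₀.powersetCard h, ∀ Hs ∈ samples H t m, ∀ H' ∈ H.powersetCard t,
      ∀ (s : A.Seed) (g : Finset N → ℝ),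
        (metaProg A M H Hs H' s).numQueries g =
          m * (A.prog (M ／ (H : Set N)) s).numQueries (sampleAverage g Hs)) ∧
    metaQueryComplexity A M B₀ h t m ≤ m * A.queryComplexity 𝓜 := by
  have hrc : B₀.card = r := by
    have h1 := hB₀.encard_eq_eRank
    rw [hr, Set.encard_coe_eq_coe_finsetCard] at h1
    exact_mod_cast h1
  have hhB : h < B₀.card := hrc ▸ hhr
  have hn : 0 < Fintype.card N := by
    have := B₀.card_le_univ
    omega
  have hfpos : 0 < fmax := by
    have h1 : 0 < 2 * ν ^ 2 * fmax := lt_of_le_of_lt (by positivity) hε'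
    exact pos_of_mul_pos_right h1 (by positivity)
  have hm : 0 < m := hpar.pos hn hfpos hε
  have hth : t < h := hpar.lt hm
  have hth' : (t : ℝ) < h := by exact_mod_cast hth
  have hhr' : (h : ℝ) < r := by exact_mod_cast hhr
  have ht0 : (0 : ℝ) ≤ t := by positivity
  have hh0 : (0 : ℝ) ≤ h := by positivity
  have hfO : 0 ≤ f O := hf.nonneg O (Set.subset_univ _)
  have hn0 : (0 : ℝ) ≤ 1 / Fintype.card N := by positivity
  have hhr1 : (h : ℝ) / r ≤ 1 := div_le_one_of_le₀ hhr'.le (by positivity)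
  refine ⟨fun _ hrob => ?_, fun hmono _ hrob => ?_, fun H hH => ⟨?_, ?_⟩, ?_, ?_⟩
  · have hth1 : (t : ℝ) / h ≤ 1 := div_le_one_of_le₀ hth'.le hh0
    refine le_trans ?_ (le_metaExpectedValue hξ ha hD hf hfmax hε hε' hn hpar A hO.1 hB₀ hhB h𝓜
      (fun E => (nonnegMonotoneSubmodularOn_zero E).toNonnegSubmodularOn)
      (fun H E hE => hf.smoothed H t hE) hα (γ := 1 - (t : ℝ) / h) (by linarith)
      (fun H S hH hd => ?_) hrob)
    · rw [hrc]
      refine sub_le_sub_right (mul_le_mul_of_nonneg_right (mul_le_mul_of_nonneg_left ?_ hα) hfO) _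
      -- The argument gives the product with the smaller losses `h / r` and `t / h`; expanding and
      -- enlarging them gives the stated form.
      exact one_sub_le_mul_one_sub (by positivity) (by positivity) hn0 hhr1
        (div_le_div_sub_self hh0 hhr') (div_le_div_sub_self ht0 hth')
    · have := hf.le_expect_union S H hd t (by omega) (by omega)
      rwa [hH] at this
  · refine le_trans ?_ (le_metaExpectedValue hξ ha hD hf hfmax hε hε' hn hpar A hO.1 hB₀ hhB h𝓜
      nonnegMonotoneSubmodularOn_zero (fun H E hE => hmono.smoothed H t hE) hα (γ := 1)
      zero_le_one (fun H S hH hd => ?_) hrob)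
    · rw [hrc]
      refine sub_le_sub_right (mul_le_mul_of_nonneg_right (mul_le_mul_of_nonneg_left ?_ hα) hfO) _
      have := one_sub_le_mul_one_sub (y := 0) (by positivity) le_rfl hn0 hhr1
        (div_le_div_sub_self hh0 hhr') le_rfl
      simpa using this
    · rw [one_mul]
      exact Finset.le_expect (Finset.powersetCard_nonempty.2 (by omega)) fun T _ =>
        hmono.mono _ _ Finset.subset_union_left (Set.subset_univ _)
  · refine injTuples_nonempty ?_
    rw [Finset.card_powersetCard, (Finset.mem_powersetCard.1 hH).2]
    exact hpar.le_choose hm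
  · intro Hs _ H' hH' s g
    exact indep_run_metaProg A M
      (hB₀.indep.subset (by exact_mod_cast (Finset.mem_powersetCard.1 hH).1)) Hs
      (Finset.mem_powersetCard.1 hH').1 s g
  · intro H _ Hs _ H' _ s g
    exact QueryProg.numQueries_smooth Hs H' g _
  · exact metaQueryComplexity_le A M B₀ h t m 𝓜 h𝓜
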